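/- Let $\Sigma=\{0,1\}$. For a nondeterministic polynomial-time Turing machine $N$ and $x\in\Sigma^*$ let $\mathrm{acc}_N(x)$ and $\mathrm{rej}_N(x)$ be the numbers of accepting and of rejecting computation paths of $N$ on input $x$, and let $\mathrm{gap}_N=\mathrm{acc}_N-\mathrm{rej}_N$. Let $\mathrm{GapP}$ be the class of the functions $\mathrm{gap}_N$, and let $\mathrm{FP}$ be the class of polynomial-time computable functions (integers are written in binary). Define the following classes of sets $A\subseteq\Sigma^*$. - $A\in\mathrm{C_{=}P}$ if there are a nondeterministic polynomial-time Turing machine $N$ and $f\in\mathrm{FP}$ such that, for all $x$, $x\in A\iff \mathrm{acc}_N(x)=f(x)$; and $A\in\mathrm{coC_{=}P}$ if $\Sigma^*\setminus A\in \mathrm{C_{=}P}$. - $A\in\mathrm{LWPP}$ if there are $g\in\mathrm{GapP}$ and $f\in\mathrm{FP}$, with $f(0^n)\in\mathbb Z\setminus\{0\}$ for all $n\in\mathbb N$, such that for all $x$: $x\in A$ implies $g(x)=f(0^{|x|})$, and $x\notin A$ implies $g(x)=0$. - For $r:\mathbb N\to\mathbb N$, $A\in r\text{-}\mathrm{LWPP}$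 if there are $g\in\mathrm{GapP}$ and $f\in\mathrm{FP}$, with $f(\langle 0^n,i\rangle)\in\mathbb Z\setminus\{0\}$ for all $n\in\mathbb N$ and $i\ge 1$ ($i$ written in binary), such that for all $x$: $x\in A$ implies that $g(x)=f(\langle 0^{|x|},i\rangle)$ for some $i\in\{1,\dots,r(|x|)\}$, and $x\notin A$ implies $g(x)=0$. - $\mathrm{Exp}\text{-}\mathrm{LWPP}=\bigcup_{c\ge 1}\,(2^{n^c+c})\text{-}\mathrm{LWPP}$. - $\mathrm{PP}$ is the class of the sets $\{x : \mathrm{acc}_N(x)>\mathrm{rej}_N(x)\}$, and, for a class $\mathcal C$, $\mathrm{PP}^{\mathcal C}$ is the union over $B\in\mathcal C$ of the analogous classes defined with nondeterministic polynomial-time oracle Turing machines with oracle $B$. **Theorem.** $\mathrm{coC_{=}P}\subseteq \mathrm{Exp}\text{-}\mathrm{LWPP}$, and hence $\mathrm{coC_{=}P}=\mathrm{Exp}\text{-}\mathrm{LWPP}$. In particular, $\mathrm{NP}\subseteq \mathrm{Exp}\text{-}\mathrm{LWPP}$. Moreover, if $\mathrm{Exp}\text{-}\mathrm{LWPP}=\mathrm{LWPP}$,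 then $\mathrm{NP}\subseteq\mathrm{LWPP}$ and $\mathrm{PP}^{\mathrm{NP}}=\mathrm{PP}$, and also $\mathrm{coC_{=}P}\subseteq\mathrm{LWPP}$ and $\mathrm{PP}^{\mathrm{coC_{=}P}}=\mathrm{PP}$. -/

import Mathlib

namespace CountingClasses

open Turing

/-! ## Nondeterministic polynomial-time (oracle) Turing machines

Deterministic polynomial-time computability is Mathlib's `Turing.TM2ComputableInPolyTime`, which
rests on the multi-stack Turing machines `Turing.TM2`. The nondeterministic machines below are the
same machines, whose control may in addition branch nondeterministically and query an oracle.
The input alphabet is `{0, 1}`, that is, `Bool`, with `false` for `0`. -/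

/-- What a machine does at a label of its program: execute a statement of Mathlib's deterministic
model, branch nondeterministically to one of two labels, or ask the oracle about the content of
the query stack and continue according to the answer. -/
inductive Instr {K : Type} (Γ : K → Type) (Λ σ : Type) where
  | run (s : TM2.Stmt Γ Λ σ)
  | guess (l₁ l₂ : Λ)
  | query (yes no : Λ)

/-- A nondeterministic oracle Turing machine: finitely many stacks with finite alphabets, finitely
many labels and finitely many internal states. A halting computation accepts or rejects,
according to the internal state in which it halts. -/
structure OracleNTM where
  /-- index type of the stacks -/
  K : Type
  [decK : DecidableEq K]
  [finK : Finite K]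
  /-- the stack that holds the input at the start -/
  inp : K
  /-- the stack that holds the question to the oracle -/
  qry : K
  /-- the alphabets of the stacks -/
  Γ : K → Type
  [finΓ : ∀ k, Finite (Γ k)]
  inpAlphabet : Γ inp ≃ Bool
  qryAlphabet : Γ qry ≃ Bool
  /-- the labels -/
  Λ : Type
  [finΛ : Finite Λ]
  main : Λ
  /-- the internal states -/
  σ : Type
  [finσ : Finite σ]
  initialState : σ
  accepting : σ → Bool
  /-- the program -/
  prog : Λ → Instr Γ Λ σ

namespace OracleNTM

variable (M : OracleNTM)

instance : DecidableEq M.K := M.decK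

/-- The configurations of a machine; those with label `none` are the halting ones. -/
abbrev Cfg : Type := TM2.Cfg M.Γ M.Λ M.σ

/-- The initial configuration on input `x`; the first symbol of `x` is on top of the input stack,
and all other stacks are empty. -/
def initCfg (x : List Bool) : M.Cfg where
  l := some M.main
  var := M.initialState
  stk := Function.update (fun _ => []) M.inp (x.map M.inpAlphabet.symm)

open Classical in
/-- The successors of a configuration, relative to the oracle `O`: none for a halting
configuration, two for a nondeterministic branching, and one otherwise. The string about which the
oracle is asked is the content of the query stack, read from the top; the stack is emptied by the
query. -/
noncomputable def next (O : Set (List Bool)) : M.Cfg → List M.Cfg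
  | ⟨none, _, _⟩ => []
  | ⟨some l, v, S⟩ =>
    match M.prog l with
    | .run s => [TM2.stepAux s v S]
    | .guess l₁ l₂ => [⟨some l₁, v, S⟩, ⟨some l₂, v, S⟩]
    | .query yes no =>
      [⟨some (if (S M.qry).map M.qryAlphabet ∈ O then yes else no), v,
        Function.update S M.qry []⟩]

/-- Every computation that starts in the configuration `c` halts after at most `t` steps. -/
def HaltsWithin (O : Set (List Bool)) : ℕ → M.Cfg → Prop
  | 0, c => c.l = none
  | t + 1, c => ∀ c' ∈ M.next O c, HaltsWithin O t c'

/-- The number of computation paths of at most `t` steps from the configuration `c` to a halting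
configuration that is accepting (for `b = true`) or rejecting (for `b = false`). -/
noncomputable def numPaths (O : Set (List Bool)) (b : Bool) : ℕ → M.Cfg → ℕ
  | 0, c => if c.l = none ∧ M.accepting c.var = b then 1 else 0
  | t + 1, c =>
    (if c.l = none ∧ M.accepting c.var = b then 1 else 0) +
      ((M.next O c).map (numPaths O b t)).sum

/-- The machine has no oracle queries in its program: it is an ordinary nondeterministic Turing
machine. -/
def QueryFree : Prop := ∀ l yes no, M.prog l ≠ .query yes no

end OracleNTM

/-- A nondeterministic polynomial-time oracle Turing machine: with every oracle and on every
input, all computation paths halt within a number of steps that is polynomial in the length of the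
input. -/
structure PolyNTM extends OracleNTM where
  time : Polynomial ℕ
  halts : ∀ (O : Set (List Bool)) (x : List Bool),
    toOracleNTM.HaltsWithin O (time.eval x.length) (toOracleNTM.initCfg x)

namespace PolyNTM

variable (N : PolyNTM)

/-- The number of accepting computation paths of `N` with oracle `O` on input `x`. -/
noncomputable def acc (O : Set (List Bool)) (x : List Bool) : ℕ :=
  N.numPaths O true (N.time.eval x.length) (N.initCfg x)

/-- The number of rejecting computation paths of `N` with oracle `O` on input `x`. -/
noncomputable def rej (O : Set (List Bool)) (x : List Bool) : ℕ :=
  N.numPaths O false (N.time.eval x.length) (N.initCfg x)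

/-- The difference between the numbers of accepting and of rejecting computation paths. -/
noncomputable def gap (O : Set (List Bool)) (x : List Bool) : ℤ :=
  (N.acc O x : ℤ) - (N.rej O x : ℤ)

end PolyNTM

/-! ## Function classes

The oracle `∅` below is a dummy argument: a machine without queries ignores it. -/

/-- The gap functions of nondeterministic polynomial-time Turing machines. -/
def GapP : Set (List Bool → ℤ) :=
  {g | ∃ N : PolyNTM, N.QueryFree ∧ ∀ x, g x = N.gap ∅ x}

/-- The sign and the binary digits of the absolute value, least significant digit first. -/
def encodeInt (z : ℤ) : List Bool := decide (z < 0) :: z.natAbs.bits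

/-- The polynomial-time computable functions from strings to integers (written in binary). All
stack alphabets of the machine are required to be finite. -/
def FP : Set (List Bool → ℤ) :=
  {f | ∃ h : TM2ComputableInPolyTime (id : List Bool → List Bool) encodeInt f,
    ∀ k, Finite (h.tm.Γ k)}

/-- The string `0ⁿ`. -/
def zeros (n : ℕ) : List Bool := List.replicate n false

/-- The pairing function on strings: the symbols of `x`, each preceded by a `1`, then a `0`,
then `y`. -/
def pair (x y : List Bool) : List Bool := (x.flatMap fun b => [true, b]) ++ false :: y

/-! ## Classes of languages -/

/-- Nondeterministic polynomial time. -/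
def NP : Set (Set (List Bool)) :=
  {A | ∃ N : PolyNTM, N.QueryFree ∧ ∀ x, x ∈ A ↔ 0 < N.acc ∅ x}

/-- Probabilistic polynomial time: more than half of the computation paths accept, that is, more
paths accept than reject. -/
def PP : Set (Set (List Bool)) :=
  {A | ∃ N : PolyNTM, N.QueryFree ∧ ∀ x, x ∈ A ↔ N.rej ∅ x < N.acc ∅ x}

/-- `PP` relative to the oracle `B`. -/
def PPOracle (B : Set (List Bool)) : Set (Set (List Bool)) :=
  {A | ∃ N : PolyNTM, ∀ x, x ∈ A ↔ N.rej B x < N.acc B x}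

/-- `PP` relative to a class of oracles. -/
def PPRel (C : Set (Set (List Bool))) : Set (Set (List Bool)) :=
  ⋃ B ∈ C, PPOracle B

/-- The class `C₌P`. -/
def CeqP : Set (Set (List Bool)) :=
  {A | ∃ N : PolyNTM, N.QueryFree ∧ ∃ f ∈ FP, ∀ x, x ∈ A ↔ (N.acc ∅ x : ℤ) = f x}

/-- The class `coC₌P` of the complements of the sets in `C₌P`. -/
def coCeqP : Set (Set (List Bool)) := {A | Aᶜ ∈ CeqP}

/-- The class `LWPP`: the target value depends on the length of the input only. -/
def LWPP : Set (Set (List Bool)) :=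
  {A | ∃ g ∈ GapP, ∃ f ∈ FP, (∀ n, f (zeros n) ≠ 0) ∧
    ∀ x, (x ∈ A → g x = f (zeros x.length)) ∧ (x ∉ A → g x = 0)}

/-- The class `r-LWPP`: for inputs of length `n` there are `r n` target values, which are indexed
by the numbers `1, …, r n`, written in binary. -/
def indexedLWPP (r : ℕ → ℕ) : Set (Set (List Bool)) :=
  {A | ∃ g ∈ GapP, ∃ f ∈ FP, (∀ n i, 1 ≤ i → f (pair (zeros n) (Nat.bits i)) ≠ 0) ∧
    ∀ x, (x ∈ A → ∃ i, 1 ≤ i ∧ i ≤ r x.length ∧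
        g x = f (pair (zeros x.length) (Nat.bits i))) ∧
      (x ∉ A → g x = 0)}

/-- The class `Exp-LWPP`, the union of the classes `r-LWPP` with `r n = 2 ^ (n ^ c + c)`. -/
def ExpLWPP : Set (Set (List Bool)) :=
  {A | ∃ c : ℕ, 1 ≤ c ∧ A ∈ indexedLWPP fun n => 2 ^ (n ^ c + c)}

end CountingClasses

/-! The sets in coC₌P are exactly the supports of gap functions. If membership means `acc x ≠ f x`,
then `acc - f` is a gap function: one branch simulates the machine, another computes `f x` and
spawns `|f x|` paths of the opposite sign (`sub_mem_GapP`). Conversely, a gap function plus a large,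
easily computed power of two is a counting function (`exists_acc_eq_two_pow_add_gap`), so the gap
vanishes exactly where this count equals the power.

Gaps have polynomially many binary digits, and Exp-LWPP has exponentially many indices. The indices
can therefore enumerate all relevant nonzero integers: the lowest digit of `i` is the sign, the
others are the absolute value. Hence every support lies in Exp-LWPP; conversely, nonzero targets
make every set of Exp-LWPP a support.

Now let coC₌P ⊆ LWPP and let `B` be in coC₌P. Both `B` and its complement are supports of gap
functions (`g` and `f(0ⁿ) - g`), and so is the set of padded pairs of a string and its correct
oracle answer. Applying the hypothesis to this set gives a gap function that is `0` on wrong answers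
and, on right ones, a nonzero `γ` depending on the padded length only. A machine with oracle `B` is
simulated by guessing the answers and multiplying by this function once per step, with a dummy call
where nothing is asked (`exists_ev_simulate`). Wrong guesses cancel, all other paths get the same
power of `γ`, and an even number of steps makes this power positive; thus PP with oracle `B` is PP
(`PPOracle_subset_PP`).

The machines are built with `Chart.Ev`, a program logic in which a postcondition assigns values to
the exits and the values are summed over all paths. Exits may carry any integer, so counting,
weighting and multiplication of gaps all become rules for composing programs. -/

namespace CountingClasses

open Turing

/-! ## Flow charts over a fixed memory -/

/-- The memory of a machine: its stacks and its internal states. -/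
structure Memory where
  K : Type
  [decK : DecidableEq K]
  [finK : Finite K]
  Γ : K → Type
  [finΓ : ∀ k, Finite (Γ k)]
  σ : Type
  [finσ : Finite σ]

namespace Memory

instance (W : Memory) : DecidableEq W.K := W.decK
instance (W : Memory) : Finite W.K := W.finK
instance (W : Memory) (k : W.K) : Finite (W.Γ k) := W.finΓ k
instance (W : Memory) : Finite W.σ := W.finσ

/-- The contents of all stacks. -/
abbrev Stk (W : Memory) : Type := ∀ k, List (W.Γ k)

/-- The alphabets of a family of stacks that is indexed by a sum. -/
@[reducible] def sumAlphabet {K₁ K₂ : Type} (Γ₁ : K₁ → Type) (Γ₂ : K₂ → Type) : K₁ ⊕ K₂ → Type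
  | .inl k => Γ₁ k
  | .inr k => Γ₂ k

/-- The memory that consists of two independent memories. -/
@[reducible] def prod (W₁ W₂ : Memory) : Memory where
  K := W₁.K ⊕ W₂.K
  Γ := sumAlphabet W₁.Γ W₂.Γ
  finΓ
    | .inl k => W₁.finΓ k
    | .inr k => W₂.finΓ k
  σ := W₁.σ × W₂.σ

/-- Stack contents of a product memory. -/
def join {W₁ W₂ : Memory} (S₁ : W₁.Stk) (S₂ : W₂.Stk) : (W₁.prod W₂).Stk
  | .inl k => S₁ k
  | .inr k => S₂ k

section
variable {W₁ W₂ : Memory} (S₁ : W₁.Stk) (S₂ : W₂.Stk)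

@[simp] theorem join_inl (k : W₁.K) : join S₁ S₂ (.inl k) = S₁ k := rfl
@[simp] theorem join_inr (k : W₂.K) : join S₁ S₂ (.inr k) = S₂ k := rfl

@[simp] theorem update_join_inl (k : W₁.K) (l : List (W₁.Γ k)) :
    Function.update (join S₁ S₂) (.inl k) l = join (Function.update S₁ k l) S₂ := by
  funext j
  rcases j with j | j
  · by_cases h : j = k
    · subst h; simp
    · rw [Function.update_of_ne (by simpa using h)]; simp [h]
  · rw [Function.update_of_ne (by simp)]; simp

@[simp] theorem update_join_inr (k : W₂.K) (l : List (W₂.Γ k)) :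
    Function.update (join S₁ S₂) (.inr k) l = join S₁ (Function.update S₂ k l) := by
  funext j
  rcases j with j | j
  · rw [Function.update_of_ne (by simp)]; simp
  · by_cases h : j = k
    · subst h; simp
    · rw [Function.update_of_ne (by simpa using h)]; simp [h]

end

end Memory

/-- Replaces the labels of a statement by `f` and the halting by the statement `E`. -/
def bindStmt {K : Type} {Γ : K → Type} {Λ Λ' σ : Type} (f : Λ → Λ') (E : TM2.Stmt Γ Λ' σ) :
    TM2.Stmt Γ Λ σ → TM2.Stmt Γ Λ' σ
  | .push k g q => .push k g (bindStmt f E q)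
  | .peek k g q => .peek k g (bindStmt f E q)
  | .pop k g q => .pop k g (bindStmt f E q)
  | .load g q => .load g (bindStmt f E q)
  | .branch p q₁ q₂ => .branch p (bindStmt f E q₁) (bindStmt f E q₂)
  | .goto l => .goto (fun v => f (l v))
  | .halt => E

/-- The configuration that results from `c` by `f` on labels, and by `E` when `c` is halting. -/
def bindCfg {K : Type} [DecidableEq K] {Γ : K → Type} {Λ Λ' σ : Type} (f : Λ → Λ')
    (E : TM2.Stmt Γ Λ' σ) : TM2.Cfg Γ Λ σ → TM2.Cfg Γ Λ' σ
  | ⟨some l, v, S⟩ => ⟨some (f l), v, S⟩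
  | ⟨none, v, S⟩ => TM2.stepAux E v S

/-- Halting is replaced by `E` inside the same statement, so `E` runs in the same machine step and
gluing programs costs no time. -/
theorem stepAux_bindStmt {K : Type} [DecidableEq K] {Γ : K → Type} {Λ Λ' σ : Type} (f : Λ → Λ')
    (E : TM2.Stmt Γ Λ' σ) (s : TM2.Stmt Γ Λ σ) (v : σ) (S : ∀ k, List (Γ k)) :
    TM2.stepAux (bindStmt f E s) v S = bindCfg f E (TM2.stepAux s v S) := by
  induction s generalizing v S with
  | branch p q₁ q₂ h₁ h₂ => cases h : p v <;> simp [bindStmt, h, h₁, h₂]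
  | goto l => rfl
  | halt => rfl
  | _ => simp_all [bindStmt]

/-- A node of a flow chart: a statement or a nondeterministic branching. -/
inductive Node {K : Type} (Γ : K → Type) (Λ σ : Type) where
  | run (s : TM2.Stmt Γ Λ σ)
  | fork (l₁ l₂ : Λ)

/-- `bindStmt` for nodes. -/
def Node.bind {K : Type} {Γ : K → Type} {Λ Λ' σ : Type} (f : Λ → Λ') (E : TM2.Stmt Γ Λ' σ) :
    Node Γ Λ σ → Node Γ Λ' σ
  | .run s => .run (bindStmt f E s)
  | .fork l₁ l₂ => .fork (f l₁) (f l₂)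

/-- A nondeterministic flow chart over the memory `W`; halting means leaving the chart. -/
structure Chart (W : Memory) where
  Λ : Type
  [finΛ : Finite Λ]
  main : Λ
  prog : Λ → Node W.Γ Λ W.σ

namespace Chart

variable {W : Memory}

instance (G : Chart W) : Finite G.Λ := G.finΛ

/-- All paths from the configuration `c` leave the chart within `t` steps, and the exits can be
given values, as allowed by `Q`, whose sum over all paths is `w`. -/
inductive Eval (G : Chart W) (Q : W.σ → W.Stk → ℤ → Prop) :
    ℕ → TM2.Cfg W.Γ G.Λ W.σ → ℤ → Prop
  | exit {t v S w} : Q v S w → Eval G Q t ⟨none, v, S⟩ w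
  | run {t l v S s w} : G.prog l = .run s → Eval G Q t (TM2.stepAux s v S) w →
      Eval G Q (t + 1) ⟨some l, v, S⟩ w
  | fork {t l v S l₁ l₂ w₁ w₂} : G.prog l = .fork l₁ l₂ → Eval G Q t ⟨some l₁, v, S⟩ w₁ →
      Eval G Q t ⟨some l₂, v, S⟩ w₂ → Eval G Q (t + 1) ⟨some l, v, S⟩ (w₁ + w₂)

/-- `Eval` from the start of the chart. -/
def Ev (G : Chart W) (v : W.σ) (S : W.Stk) (t : ℕ) (Q : W.σ → W.Stk → ℤ → Prop) (w : ℤ) : Prop :=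
  G.Eval Q t ⟨some G.main, v, S⟩ w

variable {G H : Chart W} {Q Q' : W.σ → W.Stk → ℤ → Prop} {t t' : ℕ} {v : W.σ} {S : W.Stk} {w : ℤ}

/-- An exit may leave any amount of time unused, so the time index is only an upper bound. -/
theorem Eval.mono {c} (h : G.Eval Q t c w) (hQ : ∀ v S w, Q v S w → Q' v S w) (ht : t ≤ t') :
    G.Eval Q' t' c w := by
  induction h generalizing t' with
  | exit h => exact .exit (hQ _ _ _ h)
  | run h _ ih =>
    obtain ⟨u, rfl⟩ := Nat.exists_eq_add_of_le' ht
    exact .run h (ih (Nat.le_of_succ_le_succ ht))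
  | fork h _ _ ih₁ ih₂ =>
    obtain ⟨u, rfl⟩ := Nat.exists_eq_add_of_le' ht
    exact .fork h (ih₁ (Nat.le_of_succ_le_succ ht)) (ih₂ (Nat.le_of_succ_le_succ ht))

theorem Ev.imp (h : G.Ev v S t Q w) (hQ : ∀ v S w, Q v S w → Q' v S w) : G.Ev v S t Q' w :=
  Eval.mono h hQ le_rfl

theorem Ev.mono (h : G.Ev v S t Q w) (ht : t ≤ t') : G.Ev v S t' Q w :=
  Eval.mono h (fun _ _ _ => id) ht

/-- Embedding of a chart into another one. -/
theorem Eval.embed {f : G.Λ → H.Λ} {E : TM2.Stmt W.Γ H.Λ W.σ}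
    (hf : ∀ l, H.prog (f l) = (G.prog l).bind f E)
    {c} (h : G.Eval Q t c w)
    (hE : ∀ v S w, Q v S w → H.Eval Q' t' (TM2.stepAux E v S) w) :
    H.Eval Q' (t + t') (bindCfg f E c) w := by
  induction h with
  | exit h => exact (hE _ _ _ h).mono (fun _ _ _ => id) (by omega)
  | run h _ ih =>
    rw [Nat.add_right_comm]
    refine .run (by rw [hf, h]; rfl) ?_
    rwa [stepAux_bindStmt]
  | fork h _ _ ih₁ ih₂ =>
    rw [Nat.add_right_comm]
    exact .fork (by rw [hf, h]; rfl) ih₁ ih₂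

/-! ### Constructions of flow charts -/

/-- A single statement. -/
def stmt (s : TM2.Stmt W.Γ Unit W.σ) : Chart W where
  Λ := Unit
  main := ()
  prog _ := .run s

/-- Pushes a symbol that is computed from the internal state. -/
def push (k : W.K) (f : W.σ → W.Γ k) : Chart W := stmt (.push k f .halt)

/-- Pops a symbol. -/
def pop (k : W.K) (f : W.σ → Option (W.Γ k) → W.σ) : Chart W := stmt (.pop k f .halt)

/-- Changes the internal state. -/
def load (f : W.σ → W.σ) : Chart W := stmt (.load f .halt)

theorem Ev.push {k : W.K} {f : W.σ → W.Γ k} (h : Q v (Function.update S k (f v :: S k)) w) :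
    (Chart.push k f).Ev v S 1 Q w :=
  .run rfl (.exit h)

theorem Ev.pop {k : W.K} {f : W.σ → Option (W.Γ k) → W.σ}
    (h : Q (f v (S k).head?) (Function.update S k (S k).tail) w) :
    (Chart.pop k f).Ev v S 1 Q w :=
  .run rfl (.exit h)

theorem Ev.load {f : W.σ → W.σ} (h : Q (f v) S w) : (Chart.load f).Ev v S 1 Q w :=
  .run rfl (.exit h)

/-- Sequential composition. -/
def seq (G H : Chart W) : Chart W where
  Λ := G.Λ ⊕ H.Λ
  main := .inl G.main
  prog
    | .inl l => (G.prog l).bind .inl (.goto fun _ => .inr H.main)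
    | .inr l => (H.prog l).bind .inr .halt

infixr:65 " ⨟ " => seq

/-- The value at an exit of `G` is the total value of `H` started there; summing over the exits of
`G` then sums over all paths of the composition. Continuation-passing postconditions thus replace
any bookkeeping of multisets of exits. -/
theorem Ev.seq (h : G.Ev v S t (fun v S w => H.Ev v S t' Q w) w) : (G ⨟ H).Ev v S (t + t') Q w := by
  refine Eval.embed (H := G ⨟ H) (f := Sum.inl) (E := .goto fun _ => .inr H.main)
    (fun _ => rfl) h fun v S w hw => ?_
  exact Eval.embed (H := G ⨟ H) (t' := 0) (f := Sum.inr) (E := .halt) (fun _ => rfl) hw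
    fun v S w hw => .exit hw

/-- Branching according to the internal state. -/
def ite (p : W.σ → Bool) (G H : Chart W) : Chart W where
  Λ := Option (G.Λ ⊕ H.Λ)
  main := none
  prog
    | none => .run (.branch p (.goto fun _ => some (.inl G.main)) (.goto fun _ => some (.inr H.main)))
    | some (.inl l) => (G.prog l).bind (some ∘ .inl) .halt
    | some (.inr l) => (H.prog l).bind (some ∘ .inr) .halt

theorem Ev.ite_true {p : W.σ → Bool} (hp : p v = true) (h : G.Ev v S t Q w) :
    (ite p G H).Ev v S (t + 1) Q w := by
  refine .run rfl ?_
  simp only [TM2.stepAux, hp]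
  exact Eval.embed (H := ite p G H) (t' := 0) (f := some ∘ Sum.inl) (E := .halt) (fun _ => rfl) h
    fun v S w hw => .exit hw

theorem Ev.ite_false {p : W.σ → Bool} (hp : p v = false) (h : H.Ev v S t Q w) :
    (ite p G H).Ev v S (t + 1) Q w := by
  refine .run rfl ?_
  simp only [TM2.stepAux, hp]
  exact Eval.embed (H := ite p G H) (t' := 0) (f := some ∘ Sum.inr) (E := .halt) (fun _ => rfl) h
    fun v S w hw => .exit hw

/-- Nondeterministic branching. -/
def guess (G H : Chart W) : Chart W where
  Λ := Option (G.Λ ⊕ H.Λ)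
  main := none
  prog
    | none => .fork (some (.inl G.main)) (some (.inr H.main))
    | some (.inl l) => (G.prog l).bind (some ∘ .inl) .halt
    | some (.inr l) => (H.prog l).bind (some ∘ .inr) .halt

theorem Ev.guess {w₁ w₂ : ℤ} (h₁ : G.Ev v S t Q w₁) (h₂ : H.Ev v S t' Q w₂) :
    (guess G H).Ev v S (max t t' + 1) Q (w₁ + w₂) := by
  refine .fork rfl ?_ ?_
  · exact (Eval.embed (H := Chart.guess G H) (t' := 0) (f := some ∘ Sum.inl) (E := .halt)
      (fun _ => rfl) h₁ fun v S w hw => .exit hw).mono (fun _ _ _ => id) (le_max_left _ _)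
  · exact (Eval.embed (H := Chart.guess G H) (t' := 0) (f := some ∘ Sum.inr) (E := .halt)
      (fun _ => rfl) h₂ fun v S w hw => .exit hw).mono (fun _ _ _ => id) (le_max_right _ _)

/-- Pops a symbol and leaves if the new internal state does not satisfy `p`; otherwise executes the
chart `G` and repeats. -/
def loop (k : W.K) (f : W.σ → Option (W.Γ k) → W.σ) (p : W.σ → Bool) (G : Chart W) : Chart W where
  Λ := Option G.Λ
  main := none
  prog
    | none => .run (.pop k f (.branch p (.goto fun _ => some G.main) .halt))
    | some l => (G.prog l).bind some (.goto fun _ => none)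

theorem Ev.loop_exit {k : W.K} {f : W.σ → Option (W.Γ k) → W.σ} {p : W.σ → Bool}
    (hp : p (f v (S k).head?) = false)
    (h : Q (f v (S k).head?) (Function.update S k (S k).tail) w) :
    (loop k f p G).Ev v S 1 Q w := by
  refine .run rfl ?_
  simp only [TM2.stepAux, hp]
  exact .exit h

theorem Ev.loop_step {k : W.K} {f : W.σ → Option (W.Γ k) → W.σ} {p : W.σ → Bool}
    (hp : p (f v (S k).head?) = true)
    (h : G.Ev (f v (S k).head?) (Function.update S k (S k).tail) t
      (fun v S w => (loop k f p G).Ev v S t' Q w) w) :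
    (loop k f p G).Ev v S (t + t' + 1) Q w := by
  refine .run rfl ?_
  simp only [TM2.stepAux, hp]
  exact Eval.embed (H := loop k f p G) (f := some) (E := .goto fun _ => none) (fun _ => rfl) h
    fun v S w hw => hw

/-! ### Lifting to product memories -/

end Chart

section Lift

variable {W₁ W₂ : Memory} {Λ : Type}

/-- A statement on the left part of a product memory. -/
def liftStmtL : TM2.Stmt W₁.Γ Λ W₁.σ → TM2.Stmt (W₁.prod W₂).Γ Λ (W₁.prod W₂).σ
  | .push k g q => .push (.inl k) (fun v => g v.1) (liftStmtL q)
  | .peek k g q => .peek (.inl k) (fun v s => (g v.1 s, v.2)) (liftStmtL q)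
  | .pop k g q => .pop (.inl k) (fun v s => (g v.1 s, v.2)) (liftStmtL q)
  | .load g q => .load (fun v => (g v.1, v.2)) (liftStmtL q)
  | .branch p q₁ q₂ => .branch (fun v => p v.1) (liftStmtL q₁) (liftStmtL q₂)
  | .goto l => .goto (fun v => l v.1)
  | .halt => .halt

/-- A statement on the right part of a product memory. -/
def liftStmtR : TM2.Stmt W₂.Γ Λ W₂.σ → TM2.Stmt (W₁.prod W₂).Γ Λ (W₁.prod W₂).σ
  | .push k g q => .push (.inr k) (fun v => g v.2) (liftStmtR q)
  | .peek k g q => .peek (.inr k) (fun v s => (v.1, g v.2 s)) (liftStmtR q)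
  | .pop k g q => .pop (.inr k) (fun v s => (v.1, g v.2 s)) (liftStmtR q)
  | .load g q => .load (fun v => (v.1, g v.2)) (liftStmtR q)
  | .branch p q₁ q₂ => .branch (fun v => p v.2) (liftStmtR q₁) (liftStmtR q₂)
  | .goto l => .goto (fun v => l v.2)
  | .halt => .halt

theorem stepAux_liftStmtL (s : TM2.Stmt W₁.Γ Λ W₁.σ) (v₁ : W₁.σ) (v₂ : W₂.σ) (S₁ : W₁.Stk)
    (S₂ : W₂.Stk) :
    TM2.stepAux (liftStmtL s) (v₁, v₂) (Memory.join S₁ S₂) =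
      ⟨(TM2.stepAux s v₁ S₁).l, ((TM2.stepAux s v₁ S₁).var, v₂),
        Memory.join (TM2.stepAux s v₁ S₁).stk S₂⟩ := by
  induction s generalizing v₁ S₁ with
  | push k g q ih =>
    simp only [liftStmtL, TM2.stepAux]
    rw [Memory.update_join_inl]
    exact ih _ _
  | peek k g q ih => exact ih _ _
  | pop k g q ih =>
    simp only [liftStmtL, TM2.stepAux]
    rw [Memory.update_join_inl]
    exact ih _ _
  | load g q ih => exact ih _ _
  | branch p q₁ q₂ h₁ h₂ =>
    cases h : p v₁ <;> simp only [liftStmtL, TM2.stepAux, h, cond_true, cond_false, h₁, h₂]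
  | goto l => rfl
  | halt => rfl

theorem stepAux_liftStmtR (s : TM2.Stmt W₂.Γ Λ W₂.σ) (v₁ : W₁.σ) (v₂ : W₂.σ) (S₁ : W₁.Stk)
    (S₂ : W₂.Stk) :
    TM2.stepAux (liftStmtR s) (v₁, v₂) (Memory.join S₁ S₂) =
      ⟨(TM2.stepAux s v₂ S₂).l, (v₁, (TM2.stepAux s v₂ S₂).var),
        Memory.join S₁ (TM2.stepAux s v₂ S₂).stk⟩ := by
  induction s generalizing v₂ S₂ with
  | push k g q ih =>
    simp only [liftStmtR, TM2.stepAux]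
    rw [Memory.update_join_inr]
    exact ih _ _
  | peek k g q ih => exact ih _ _
  | pop k g q ih =>
    simp only [liftStmtR, TM2.stepAux]
    rw [Memory.update_join_inr]
    exact ih _ _
  | load g q ih => exact ih _ _
  | branch p q₁ q₂ h₁ h₂ =>
    cases h : p v₂ <;> simp only [liftStmtR, TM2.stepAux, h, cond_true, cond_false, h₁, h₂]
  | goto l => rfl
  | halt => rfl

end Lift

namespace Chart

variable {W₁ W₂ : Memory}

/-- A flow chart on the left part of a product memory. -/
def liftL (G : Chart W₁) : Chart (W₁.prod W₂) where
  Λ := G.Λ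
  main := G.main
  prog l := match G.prog l with
    | .run s => .run (liftStmtL s)
    | .fork l₁ l₂ => .fork l₁ l₂

/-- A flow chart on the right part of a product memory. -/
def liftR (G : Chart W₂) : Chart (W₁.prod W₂) where
  Λ := G.Λ
  main := G.main
  prog l := match G.prog l with
    | .run s => .run (liftStmtR s)
    | .fork l₁ l₂ => .fork l₁ l₂

/-- A frame rule: the chart cannot touch the right memory, which is therefore a fixed parameter of
the postcondition. -/
theorem Eval.liftL {G : Chart W₁} {v₂ : W₂.σ} {S₂ : W₂.Stk} {Q t c w}
    (h : G.Eval (fun v S w => Q (v, v₂) (Memory.join S S₂) w) t c w) :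
    (G.liftL (W₂ := W₂)).Eval Q t ⟨c.l, (c.var, v₂), Memory.join c.stk S₂⟩ w := by
  induction h with
  | exit h => exact .exit h
  | run h _ ih =>
    refine .run (by simp only [Chart.liftL, h]; rfl) ?_
    erw [stepAux_liftStmtL]
    exact ih
  | fork h _ _ ih₁ ih₂ => exact .fork (by simp only [Chart.liftL, h]) ih₁ ih₂

theorem Eval.liftR {G : Chart W₂} {v₁ : W₁.σ} {S₁ : W₁.Stk} {Q t c w}
    (h : G.Eval (fun v S w => Q (v₁, v) (Memory.join S₁ S) w) t c w) :
    (G.liftR (W₁ := W₁)).Eval Q t ⟨c.l, (v₁, c.var), Memory.join S₁ c.stk⟩ w := by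
  induction h with
  | exit h => exact .exit h
  | run h _ ih =>
    refine .run (by simp only [Chart.liftR, h]; rfl) ?_
    erw [stepAux_liftStmtR]
    exact ih
  | fork h _ _ ih₁ ih₂ => exact .fork (by simp only [Chart.liftR, h]) ih₁ ih₂

theorem Ev.liftL {G : Chart W₁} {v₁ : W₁.σ} {S₁ : W₁.Stk} {v₂ : W₂.σ} {S₂ : W₂.Stk} {Q t w}
    (h : G.Ev v₁ S₁ t (fun v S w => Q (v, v₂) (Memory.join S S₂) w) w) :
    (G.liftL (W₂ := W₂)).Ev (v₁, v₂) (Memory.join S₁ S₂) t Q w :=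
  Eval.liftL h

theorem Ev.liftR {G : Chart W₂} {v₁ : W₁.σ} {S₁ : W₁.Stk} {v₂ : W₂.σ} {S₂ : W₂.Stk} {Q t w}
    (h : G.Ev v₂ S₂ t (fun v S w => Q (v₁, v) (Memory.join S₁ S) w) w) :
    (G.liftR (W₁ := W₁)).Ev (v₁, v₂) (Memory.join S₁ S₂) t Q w :=
  Eval.liftR h

end Chart

/-! ## Polynomial bounds -/

/-- The function is bounded by a polynomial. -/
def PolyBdd (f : ℕ → ℕ) : Prop := ∃ p : Polynomial ℕ, ∀ n, f n ≤ p.eval n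

theorem eval_mono_nat (p : Polynomial ℕ) {m n : ℕ} (h : m ≤ n) : p.eval m ≤ p.eval n := by
  simp only [Polynomial.eval_eq_sum_range]
  gcongr

namespace PolyBdd

variable {f g : ℕ → ℕ}

theorem const (c : ℕ) : PolyBdd fun _ => c := ⟨Polynomial.C c, by simp⟩

theorem id : PolyBdd fun n => n := ⟨Polynomial.X, by simp⟩

theorem eval (p : Polynomial ℕ) : PolyBdd fun n => p.eval n := ⟨p, fun _ => le_rfl⟩

theorem add (hf : PolyBdd f) (hg : PolyBdd g) : PolyBdd fun n => f n + g n :=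
  let ⟨p, hp⟩ := hf
  let ⟨q, hq⟩ := hg
  ⟨p + q, fun n => by simpa using add_le_add (hp n) (hq n)⟩

theorem mul (hf : PolyBdd f) (hg : PolyBdd g) : PolyBdd fun n => f n * g n :=
  let ⟨p, hp⟩ := hf
  let ⟨q, hq⟩ := hg
  ⟨p * q, fun n => by simpa using Nat.mul_le_mul (hp n) (hq n)⟩

theorem pow (hf : PolyBdd f) (k : ℕ) : PolyBdd fun n => f n ^ k := by
  induction k with
  | zero => simpa using const 1
  | succ k ih => simpa only [pow_succ] using ih.mul hf

theorem comp (hf : PolyBdd f) (hg : PolyBdd g) : PolyBdd fun n => f (g n) :=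
  let ⟨p, hp⟩ := hf
  let ⟨q, hq⟩ := hg
  ⟨p.comp q, fun n => by
    rw [Polynomial.eval_comp]
    exact (hp _).trans (eval_mono_nat p (hq n))⟩

theorem exists_eval_le_mul_pow (p : Polynomial ℕ) : ∃ a d, ∀ n, 1 ≤ n → p.eval n ≤ a * n ^ d := by
  -- The factor is the sum of the coefficients; each power is at most the top power because `n ≥ 1`.
  refine ⟨p.eval 1, p.natDegree, fun n hn => ?_⟩
  simp only [Polynomial.eval_eq_sum_range, one_pow, mul_one, Finset.sum_mul]
  refine Finset.sum_le_sum fun i hi => ?_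
  exact Nat.mul_le_mul_left _ (Nat.pow_le_pow_right hn (by simp at hi; omega))

theorem exists_le_pow_add (hf : PolyBdd f) : ∃ c, 1 ≤ c ∧ ∀ n, f n ≤ n ^ c + c := by
  obtain ⟨p, hp⟩ := hf
  obtain ⟨a, d, h⟩ := exists_eval_le_mul_pow p
  -- For `n ≥ 2` the factor `a` is absorbed by `n ^ a`, which needs `c ≥ a + d`. The summands
  -- `p.eval 0` and `p.eval 1` cover the two remaining arguments.
  refine ⟨a + d + p.eval 0 + p.eval 1 + 1, by omega, fun n => (hp n).trans ?_⟩
  rcases n with _ | _ | n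
  · omega
  · rw [zero_add, one_pow]; omega
  · refine (h _ (by omega)).trans (le_add_right ?_)
    calc a * (n + 1 + 1) ^ d ≤ (n + 1 + 1) ^ a * (n + 1 + 1) ^ d :=
          Nat.mul_le_mul_right _ (Nat.lt_pow_self (by omega)).le
      _ = (n + 1 + 1) ^ (a + d) := (pow_add _ _ _).symm
      _ ≤ _ := Nat.pow_le_pow_right (by omega) (by omega)

/-- This is the shape of bound that `clock` writes down in unary. -/
theorem exists_le_add_pow (hf : PolyBdd f) : ∃ c, 1 ≤ c ∧ ∀ n, f n ≤ (n + c) ^ c := by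
  obtain ⟨c, hc, h⟩ := hf.exists_le_pow_add
  refine ⟨c + 1, by omega, fun n => (h n).trans ?_⟩
  calc n ^ c + c ≤ (n + (c + 1)) ^ c + (n + (c + 1)) ^ c * c := by
        refine add_le_add (Nat.pow_le_pow_left (by omega) _) ?_
        exact Nat.le_mul_of_pos_left _ (by positivity)
    _ = (n + (c + 1)) ^ c * (c + 1) := by ring
    _ ≤ _ := by rw [pow_succ]; exact Nat.mul_le_mul_left _ (by omega)

end PolyBdd

/-! ## Flow charts and machines -/

/-- The stack contents with `l` on the stack `k` and all other stacks empty. -/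
def Memory.single {W : Memory} (k : W.K) (l : List (W.Γ k)) : W.Stk :=
  Function.update (fun _ => []) k l

/-- The greatest number of symbols that a statement pushes. -/
def pushes {K : Type} {Γ : K → Type} {Λ σ : Type} : TM2.Stmt Γ Λ σ → ℕ
  | .push _ _ q => pushes q + 1
  | .peek _ _ q => pushes q
  | .pop _ _ q => pushes q
  | .load _ q => pushes q
  | .branch _ q₁ q₂ => max (pushes q₁) (pushes q₂)
  | .goto _ => 0
  | .halt => 0

theorem length_stepAux_le {K : Type} [DecidableEq K] {Γ : K → Type} {Λ σ : Type}
    (s : TM2.Stmt Γ Λ σ) (v : σ) (S : ∀ k, List (Γ k)) (B : ℕ) (h : ∀ k, (S k).length ≤ B) (k : K) :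
    ((TM2.stepAux s v S).stk k).length ≤ B + pushes s := by
  induction s generalizing v S B with
  | push j g q ih =>
    rw [pushes, Nat.add_comm (pushes q), ← Nat.add_assoc]
    refine ih _ _ _ fun i => ?_
    by_cases hi : i = j
    · subst hi; simpa using h i
    · simpa [hi] using (h i).trans (Nat.le_succ _)
  | peek j g q ih => exact ih _ _ _ h
  | pop j g q ih =>
    refine ih _ _ _ fun i => ?_
    by_cases hi : i = j
    · subst hi; simpa using (Nat.sub_le _ _).trans (h i)
    · simpa [hi] using h i
  | load g q ih => exact ih _ _ _ h
  | branch p q₁ q₂ h₁ h₂ =>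
    rw [pushes]
    cases hp : p v
    · simpa [hp] using (h₂ v S B h).trans (by omega)
    · simpa [hp] using (h₁ v S B h).trans (by omega)
  | goto l => simpa [pushes] using h k
  | halt => simpa [pushes] using h k

namespace Chart

variable {W : Memory}

theorem exists_pushes_le (G : Chart W) : ∃ D, ∀ l s, G.prog l = .run s → pushes s ≤ D := by
  obtain ⟨D, hD⟩ := Set.Finite.bddAbove (Set.finite_range fun l =>
    match G.prog l with
    | .run s => pushes s
    | .fork _ _ => 0)
  refine ⟨D, fun l s h => ?_⟩
  have := hD ⟨l, rfl⟩
  simpa [h] using this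

/-- The stacks grow at most linearly with the time. -/
theorem Eval.size {G : Chart W} {D : ℕ} (hD : ∀ l s, G.prog l = .run s → pushes s ≤ D)
    {Q t c w} (h : G.Eval Q t c w) {B : ℕ} (hB : ∀ k, (c.stk k).length ≤ B) :
    G.Eval (fun v S w => Q v S w ∧ ∀ k, (S k).length ≤ B + D * t) t c w := by
  induction h generalizing B with
  | exit h => exact .exit ⟨h, fun k => (hB k).trans (Nat.le_add_right _ _)⟩
  | run h _ ih =>
    refine .run h ((ih fun k => length_stepAux_le _ _ _ B hB k).mono (fun v S w h' => ?_) le_rfl)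
    refine ⟨h'.1, fun k => (h'.2 k).trans ?_⟩
    have := hD _ _ h
    rw [mul_add, mul_one]
    omega
  | fork h _ _ ih₁ ih₂ =>
    refine .fork h ((ih₁ hB).mono (fun v S w h' => ⟨h'.1, fun k => (h'.2 k).trans ?_⟩) le_rfl)
      ((ih₂ hB).mono (fun v S w h' => ⟨h'.1, fun k => (h'.2 k).trans ?_⟩) le_rfl) <;>
    · rw [mul_add]; omega

/-- The machine that executes a flow chart. -/
@[reducible] def toNTM (G : Chart W) (inp : W.K) (e : W.Γ inp ≃ Bool) (v₀ : W.σ)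
    (acc : W.σ → Bool) : OracleNTM where
  K := W.K
  decK := W.decK
  finK := W.finK
  inp := inp
  qry := inp
  Γ := W.Γ
  finΓ := W.finΓ
  inpAlphabet := e
  qryAlphabet := e
  Λ := G.Λ
  finΛ := G.finΛ
  main := G.main
  σ := W.σ
  finσ := W.finσ
  initialState := v₀
  accepting := acc
  prog l := match G.prog l with
    | .run s => .run s
    | .fork l₁ l₂ => .guess l₁ l₂

theorem queryFree_toNTM (G : Chart W) (inp : W.K) (e : W.Γ inp ≃ Bool) (v₀ : W.σ)
    (acc : W.σ → Bool) : (G.toNTM inp e v₀ acc).QueryFree := by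
  intro l yes no h
  dsimp only at h
  split at h <;> cases h

theorem numPaths_none (M : OracleNTM) (O b t v S) :
    M.numPaths O b t ⟨none, v, S⟩ = if M.accepting v = b then 1 else 0 := by
  cases t <;> simp [OracleNTM.numPaths, OracleNTM.next]

/-- The value at an exit depends on acceptance alone, so the total is the number of accepting paths
and the number of rejecting paths, each times its weight. -/
theorem Eval.toNTM {G : Chart W} {inp : W.K} {e : W.Γ inp ≃ Bool} {v₀ : W.σ}
    {acc : W.σ → Bool} {wt : Bool → ℤ} (O : Set (List Bool)) {t c w}
    (h : G.Eval (fun v _ w => w = wt (acc v)) t c w) :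
    (G.toNTM inp e v₀ acc).HaltsWithin O t c ∧
      w = wt true * (G.toNTM inp e v₀ acc).numPaths O true t c +
        wt false * (G.toNTM inp e v₀ acc).numPaths O false t c := by
  induction h with
  | @exit t v S w h =>
    constructor
    · cases t <;> simp [OracleNTM.HaltsWithin, OracleNTM.next]
    · subst h
      rw [numPaths_none, numPaths_none]
      dsimp only
      rcases Bool.eq_false_or_eq_true (acc v) with h | h <;> simp [h]
  | run h _ ih =>
    simpa [OracleNTM.HaltsWithin, OracleNTM.numPaths, OracleNTM.next, h] using ih
  | fork h _ _ ih₁ ih₂ =>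
    simp [OracleNTM.HaltsWithin, OracleNTM.numPaths, OracleNTM.next, h]
    refine ⟨⟨ih₁.1, ih₂.1⟩, ?_⟩
    rw [ih₁.2, ih₂.2]
    ring

/-- A flow chart that leaves within polynomial time, with values given by acceptance and
rejection, yields a nondeterministic polynomial-time machine. -/
theorem exists_polyNTM (G : Chart W) {inp : W.K} (e : W.Γ inp ≃ Bool) {v₀ : W.σ}
    (acc : W.σ → Bool) (wt : Bool → ℤ) {g : List Bool → ℤ} {T : ℕ → ℕ} (hT : PolyBdd T)
    (h : ∀ x, G.Ev v₀ (Memory.single inp (x.map e.symm)) (T x.length)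
      (fun v _ w => w = wt (acc v)) (g x)) :
    ∃ N : PolyNTM, N.QueryFree ∧ ∀ x, g x = wt true * N.acc ∅ x + wt false * N.rej ∅ x := by
  obtain ⟨p, hp⟩ := hT
  have key := fun O x => Eval.toNTM (inp := inp) (e := e) (v₀ := v₀) O ((h x).mono (hp _))
  exact ⟨⟨G.toNTM inp e v₀ acc, p, fun O x => (key O x).1⟩, G.queryFree_toNTM inp e v₀ acc,
    fun x => (key ∅ x).2⟩

/-- The memory of a machine. -/
@[reducible] def memNTM (M : OracleNTM) : Memory where
  K := M.K
  decK := M.decK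
  finK := M.finK
  Γ := M.Γ
  finΓ := M.finΓ
  σ := M.σ
  finσ := M.finσ

/-- The flow chart of a machine without queries. -/
@[reducible] def ofNTM (M : OracleNTM) : Chart (memNTM M) where
  Λ := M.Λ
  finΛ := M.finΛ
  main := M.main
  prog l := match M.prog l with
    | .run s => .run s
    | .guess l₁ l₂ => .fork l₁ l₂
    | .query _ _ => .run .halt

theorem eval_ofNTM {M : OracleNTM} (hM : M.QueryFree) (a r : ℤ) {O t} {c : M.Cfg}
    (h : M.HaltsWithin O t c) :
    (ofNTM M).Eval (fun v _ w => w = if M.accepting v then a else r) t c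
      (a * M.numPaths O true t c + r * M.numPaths O false t c) := by
  induction t generalizing c with
  | zero =>
    obtain ⟨l, v, S⟩ := c
    obtain rfl : l = none := h
    refine .exit ?_
    cases hv : M.accepting v <;> simp [OracleNTM.numPaths, hv]
  | succ t ih =>
    obtain ⟨_ | l, v, S⟩ := c
    · refine .exit ?_
      simp only [numPaths_none]
      cases hv : M.accepting v <;> simp
    · rw [OracleNTM.HaltsWithin] at h
      cases hl : M.prog l with
      | run s =>
        refine .run (s := s) (by simp [hl]) ?_
        simp [OracleNTM.next, hl] at h
        simpa [OracleNTM.numPaths, OracleNTM.next, hl] using ih h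
      | guess l₁ l₂ =>
        simp [OracleNTM.next, hl] at h
        have := Eval.fork (G := ofNTM M) (l := l) (by simp only [hl]) (ih h.1) (ih h.2)
        convert this using 1
        simp [OracleNTM.numPaths, OracleNTM.next, hl]
        ring
      | query yes no => exact absurd hl (hM l yes no)

/-- The weights `a` and `r` are left free: `(1, -1)` gives the gap, `(1, 0)` the number of accepting
paths, and `(d, -d)` multiplies the value `d` of a continuation by the gap. The bound on the stacks
allows them to be emptied in polynomial time afterwards. -/
theorem exists_chart_of_polyNTM (N : PolyNTM) (hN : N.QueryFree) :
    ∃ (W : Memory) (G : Chart W) (inp : W.K) (e : W.Γ inp ≃ Bool) (v₀ : W.σ) (acc : W.σ → Bool)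
      (T : ℕ → ℕ), PolyBdd T ∧ ∀ (a r : ℤ) (x : List Bool),
        G.Ev v₀ (Memory.single inp (x.map e.symm)) (T x.length)
          (fun v S w => w = (if acc v then a else r) ∧ ∀ k, (S k).length ≤ T x.length)
          (a * N.acc ∅ x + r * N.rej ∅ x) := by
  obtain ⟨D, hD⟩ := (ofNTM N.toOracleNTM).exists_pushes_le
  refine ⟨memNTM N.toOracleNTM, ofNTM N.toOracleNTM, N.inp, N.inpAlphabet, N.initialState,
    N.accepting, fun n => n + (D + 1) * N.time.eval n,
    .add .id (.mul (.const _) (.eval _)), fun a r x => ?_⟩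
  have := (eval_ofNTM hN a r (N.halts ∅ x)).size hD (B := x.length) fun k => by
    by_cases hk : k = N.inp
    · subst hk; simp [OracleNTM.initCfg]
    · simp [OracleNTM.initCfg, hk]
  refine Eval.mono this (fun v S w h => ⟨h.1, fun k => (h.2 k).trans ?_⟩) ?_
  all_goals dsimp only; rw [add_mul]; omega

/-- The deterministic machine that executes a flow chart, for charts that do not branch. -/
@[reducible] noncomputable def toFinTM2 (G : Chart W) (k₀ k₁ : W.K) (v₀ : W.σ) : FinTM2 where
  K := W.K
  kDecidableEq := W.decK
  kFin := Fintype.ofFinite W.K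
  k₀ := k₀
  k₁ := k₁
  Γ := W.Γ
  Λ := G.Λ
  main := G.main
  ΛFin := Fintype.ofFinite G.Λ
  σ := W.σ
  initialState := v₀
  σFin := Fintype.ofFinite W.σ
  Γk₀Fin := Fintype.ofFinite (W.Γ k₀)
  m l := match G.prog l with
    | .run s => s
    | .fork _ _ => .halt

/-- With exits of value `1`, the total counts paths. A fork contributes at least `2`, so a total of
`1` certifies that the computation is deterministic. -/
theorem Eval.one_le {G : Chart W} {Q t c w} (h : G.Eval Q t c w) (hQ : ∀ v S w, Q v S w → w = 1) :
    1 ≤ w := by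
  induction h with
  | exit h => exact (hQ _ _ _ h).ge
  | run _ _ ih => exact ih
  | fork _ _ _ ih₁ ih₂ => omega

theorem Eval.toFinTM2 {G : Chart W} {k₀ k₁ : W.K} {v₀ v₁ : W.σ} {S₁ : W.Stk} {t c w}
    (h : G.Eval (fun v S w => v = v₁ ∧ S = S₁ ∧ w = 1) t c w) (hw : w = 1) :
    ∃ n ≤ t, (flip bind (G.toFinTM2 k₀ k₁ v₀).step)^[n] (some c) = some ⟨none, v₁, S₁⟩ := by
  induction h with
  | exit h =>
    obtain ⟨rfl, rfl, -⟩ := h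
    exact ⟨0, Nat.zero_le _, rfl⟩
  | run h _ ih =>
    obtain ⟨n, hn, e⟩ := ih hw
    refine ⟨n + 1, by omega, ?_⟩
    rw [Function.iterate_succ_apply]
    refine Eq.trans (congrArg _ ?_) e
    change some (TM2.stepAux _ _ _) = _
    simp only [h]
    rfl
  | fork _ h₁ h₂ _ _ =>
    have := h₁.one_le fun _ _ _ h => h.2.2
    have := h₂.one_le fun _ _ _ h => h.2.2
    omega

/-- A flow chart that computes `f` without branching shows that `f` is computable in polynomial
time. -/
theorem mem_FP (G : Chart W) {k₀ k₁ : W.K} (e₀ : W.Γ k₀ ≃ Bool) (e₁ : W.Γ k₁ ≃ Bool) {v₀ : W.σ}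
    {f : List Bool → ℤ} {T : ℕ → ℕ} (hT : PolyBdd T)
    (h : ∀ x, G.Ev v₀ (Memory.single k₀ (x.map e₀.symm)) (T x.length)
      (fun v S w => v = v₀ ∧ S = Memory.single k₁ ((encodeInt (f x)).map e₁.symm) ∧ w = 1) 1) :
    f ∈ FP := by
  obtain ⟨p, hp⟩ := hT
  have key := fun x => Eval.toFinTM2 (k₀ := k₀) (k₁ := k₁) (v₀ := v₀) ((h x).mono (hp _)) rfl
  -- `initList` and `haltList` are defined by case distinction on the stack index; `Memory.single`
  -- is brought into that form.
  have stk : ∀ (k : W.K) (l : List (W.Γ k)), Memory.single k l = fun j =>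
      @dite (List (W.Γ j)) (j = k) (W.decK j k) (fun h => by rw [h]; exact l) fun _ => [] := by
    intro k l
    funext j
    by_cases hj : j = k
    · subst hj; simp [Memory.single]
    · simp [Memory.single, hj]
  have main : ∀ x, ∃ n ≤ p.eval x.length,
      (flip bind (G.toFinTM2 k₀ k₁ v₀).step)^[n]
        (some (initList (G.toFinTM2 k₀ k₁ v₀) (x.map e₀.symm))) =
      some (haltList (G.toFinTM2 k₀ k₁ v₀) ((encodeInt (f x)).map e₁.symm)) := by
    intro x
    obtain ⟨n, hn, e⟩ := key x
    refine ⟨n, hn, ?_⟩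
    rw [stk, stk] at e
    exact e
  choose n hn e using main
  exact ⟨{ tm := G.toFinTM2 k₀ k₁ v₀
           inputAlphabet := e₀
           outputAlphabet := e₁
           time := p
           outputsFun := fun x => ⟨⟨n x, e x⟩, hn x⟩ }, W.finΓ⟩

/-- The memory of a deterministic machine. -/
@[reducible] def memFinTM2 (M : FinTM2) (hM : ∀ k, Finite (M.Γ k)) : Memory where
  K := M.K
  decK := M.kDecidableEq
  finK := @Finite.of_fintype _ M.kFin
  Γ := M.Γ
  finΓ := hM
  σ := M.σ
  finσ := @Finite.of_fintype _ M.σFin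

/-- The flow chart of a deterministic machine. -/
@[reducible] def ofFinTM2 (M : FinTM2) (hM : ∀ k, Finite (M.Γ k)) : Chart (memFinTM2 M hM) where
  Λ := M.Λ
  finΛ := @Finite.of_fintype _ M.ΛFin
  main := M.main
  prog l := .run (M.m l)

theorem eval_ofFinTM2 (M : FinTM2) (hM : ∀ k, Finite (M.Γ k)) (w : ℤ) (n : ℕ) (c : M.Cfg)
    (v₁ : M.σ) (S₁ : ∀ k, List (M.Γ k)) (h : (flip bind M.step)^[n] (some c) = some ⟨none, v₁, S₁⟩) :
    (ofFinTM2 M hM).Eval (fun v S w' => v = v₁ ∧ S = S₁ ∧ w' = w) n c w := by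
  induction n generalizing c with
  | zero =>
    obtain rfl : c = ⟨none, v₁, S₁⟩ := Option.some.inj h
    exact .exit ⟨rfl, rfl, rfl⟩
  | succ n ih =>
    -- A halting configuration has no successor and `none` is absorbing, so the machine cannot halt
    -- before step `n`.
    have hnone : ∀ m : ℕ, (flip bind M.step)^[m] (none : Option M.Cfg) = none := fun m => by
      induction m with
      | zero => rfl
      | succ m ih => rw [Function.iterate_succ_apply]; exact ih
    rw [Function.iterate_succ_apply] at h
    obtain ⟨_ | l, v, S⟩ := c
    · change (flip bind M.step)^[n] none = _ at h
      rw [hnone] at h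
      cases h
    · exact .run rfl (ih _ h)

/-- The computation has a single path, so it passes any value `a` of the continuation through
unchanged. The output is short because stacks grow at most linearly with the time. -/
theorem exists_chart_of_FP {f : List Bool → ℤ} (hf : f ∈ FP) :
    ∃ (W : Memory) (G : Chart W) (k₀ k₁ : W.K) (e₀ : W.Γ k₀ ≃ Bool) (e₁ : W.Γ k₁ ≃ Bool) (v₀ : W.σ)
      (T : ℕ → ℕ), PolyBdd T ∧ ∀ (a : ℤ) (x : List Bool),
        G.Ev v₀ (Memory.single k₀ (x.map e₀.symm)) (T x.length)
          (fun _ S w => S k₁ = (encodeInt (f x)).map e₁.symm ∧ (encodeInt (f x)).length ≤ T x.length ∧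
            w = a) a := by
  obtain ⟨h, hΓ⟩ := hf
  obtain ⟨D, hD⟩ := (ofFinTM2 h.tm hΓ).exists_pushes_le
  refine ⟨memFinTM2 h.tm hΓ, ofFinTM2 h.tm hΓ, h.tm.k₀, h.tm.k₁, h.inputAlphabet, h.outputAlphabet,
    h.tm.initialState, fun n => n + (D + 1) * h.time.eval n,
    .add .id (.mul (.const _) (.eval _)), fun a x => ?_⟩
  obtain ⟨⟨n, e⟩, hn⟩ := h.outputsFun x
  have stk : (initList h.tm (x.map h.inputAlphabet.symm)).stk =
      Memory.single (W := memFinTM2 h.tm hΓ) h.tm.k₀ (x.map h.inputAlphabet.symm) := by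
    funext j
    by_cases hj : j = h.tm.k₀
    · subst hj; simp [Memory.single, initList]
    · simp [Memory.single, initList, hj]
  have main := (eval_ofFinTM2 h.tm hΓ a n _ _ _ e).size hD (B := x.length) fun k => by
    erw [stk]
    by_cases hk : k = h.tm.k₀
    · subst hk; simp [Memory.single]
    · simp [Memory.single, hk]
  have hn' : n ≤ h.time.eval x.length := hn
  rw [Ev, ← stk]
  refine Eval.mono main ?_ (by dsimp only; rw [add_mul]; omega)
  rintro _ _ _ ⟨⟨-, rfl, rfl⟩, hs⟩
  have h1 : (haltList h.tm ((encodeInt (f x)).map h.outputAlphabet.symm)).stk h.tm.k₁ =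
      (encodeInt (f x)).map h.outputAlphabet.symm := by
    simp [haltList]
  refine ⟨h1, ?_, rfl⟩
  have h2 := hs h.tm.k₁
  replace h2 := (congrArg List.length h1).symm.le.trans h2
  rw [List.length_map] at h2
  have := Nat.mul_le_mul_left D hn'
  dsimp only
  rw [add_mul]
  omega

end Chart

/-! ## Routines with working stacks -/

/-- The names of the working stacks. -/
inductive WorkStack
  | X | T | P | R | U | C
  deriving DecidableEq

namespace WorkStack

instance : Finite WorkStack :=
  Finite.of_injective (β := Fin 6)
    (fun | X => 0 | T => 1 | P => 2 | R => 3 | U => 4 | C => 5) fun a b => by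
      cases a <;> cases b <;> simp

end WorkStack

/-- A register for the symbol read last, and two flags. -/
structure Reg where
  r : Option Bool
  a : Bool
  s : Bool

instance : Finite Reg :=
  Finite.of_injective (β := Option Bool × Bool × Bool) (fun ρ => (ρ.r, ρ.a, ρ.s)) fun ρ ρ' h => by
    cases ρ; cases ρ'; simpa using h

/-- The symbol in the register. -/
def Reg.bit (ρ : Reg) : Bool := ρ.r.getD false

@[simp] theorem Reg.bit_mk (x : Bool) (a s : Bool) : (Reg.mk (some x) a s).bit = x := rfl

/-- The memory with the working stacks. -/
@[reducible] def work : Memory where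
  K := WorkStack
  Γ _ := Bool
  σ := Reg

/-- Contents of the working stacks. -/
def wstk (x t p r u c : List Bool) : work.Stk
  | .X => x
  | .T => t
  | .P => p
  | .R => r
  | .U => u
  | .C => c

section wstk

variable (x t p r u c l : List Bool)

@[simp] theorem wstk_X : wstk x t p r u c .X = x := rfl
@[simp] theorem wstk_T : wstk x t p r u c .T = t := rfl
@[simp] theorem wstk_P : wstk x t p r u c .P = p := rfl
@[simp] theorem wstk_R : wstk x t p r u c .R = r := rfl
@[simp] theorem wstk_U : wstk x t p r u c .U = u := rfl
@[simp] theorem wstk_C : wstk x t p r u c .C = c := rfl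

@[simp] theorem update_wstk_X :
    Function.update (β := fun _ : WorkStack => List Bool) (wstk x t p r u c) .X l = wstk l t p r u c := by
  funext k; cases k <;> rfl
@[simp] theorem update_wstk_T :
    Function.update (β := fun _ : WorkStack => List Bool) (wstk x t p r u c) .T l = wstk x l p r u c := by
  funext k; cases k <;> rfl
@[simp] theorem update_wstk_P :
    Function.update (β := fun _ : WorkStack => List Bool) (wstk x t p r u c) .P l = wstk x t l r u c := by
  funext k; cases k <;> rfl
@[simp] theorem update_wstk_R :
    Function.update (β := fun _ : WorkStack => List Bool) (wstk x t p r u c) .R l = wstk x t p l u c := by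
  funext k; cases k <;> rfl
@[simp] theorem update_wstk_U :
    Function.update (β := fun _ : WorkStack => List Bool) (wstk x t p r u c) .U l = wstk x t p r l c := by
  funext k; cases k <;> rfl
@[simp] theorem update_wstk_C :
    Function.update (β := fun _ : WorkStack => List Bool) (wstk x t p r u c) .C l = wstk x t p r u l := by
  funext k; cases k <;> rfl

end wstk

theorem Memory.join_nil {W₁ W₂ : Memory} :
    Memory.join (fun _ => [] : W₁.Stk) (fun _ => [] : W₂.Stk) = fun _ => [] := by
  funext k; cases k <;> rfl

theorem single_X {W : Memory} (l : List Bool) :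
    Memory.single (W := work.prod W) (.inl .X) l =
      Memory.join (wstk l [] [] [] [] []) (fun _ => []) := by
  rw [Memory.single, ← Memory.join_nil, Memory.update_join_inl]
  congr 1
  funext k
  cases k <;> rfl

theorem single_C {W : Memory} (l : List Bool) :
    Memory.single (W := work.prod W) (.inl .C) l =
      Memory.join (wstk [] [] [] [] [] l) (fun _ => []) := by
  rw [Memory.single, ← Memory.join_nil, Memory.update_join_inl]
  congr 1
  funext k
  cases k <;> rfl

/-! ### Loops, and moving and emptying stacks -/

namespace Chart

/-- The rule for a loop that is deterministic on the level of the invariant `I`, which is indexed by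
the content of the stack that controls the loop. -/
theorem Ev.each {W : Memory} {k : W.K} {f : W.σ → Option (W.Γ k) → W.σ} {p : W.σ → Bool}
    {G : Chart W} (I : List (W.Γ k) → W.σ → W.Stk → Prop) {t : ℕ} {w : ℤ}
    (hI : ∀ l v S, I l v S → S k = l)
    (hp : ∀ v x, p (f v (some x)) = true) (hp' : ∀ v, p (f v none) = false)
    (hstep : ∀ x l v S, I (x :: l) v S → ∀ Q : W.σ → W.Stk → ℤ → Prop,
      (∀ v' S', I l v' S' → Q v' S' w) → G.Ev (f v (some x)) (Function.update S k l) t Q w)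
    {Q : W.σ → W.Stk → ℤ → Prop} (l : List (W.Γ k)) {v : W.σ} {S : W.Stk} (h : I l v S)
    (hexit : ∀ v S, I [] v S → Q (f v none) (Function.update S k []) w) :
    (loop k f p G).Ev v S (l.length * (t + 1) + 1) Q w := by
  induction l generalizing v S with
  | nil =>
    have hk := hI _ _ _ h
    refine (Ev.loop_exit (by rw [hk]; exact hp' v) ?_).mono (by simp)
    rw [hk]
    exact hexit _ _ h
  | cons x l ih =>
    have hk := hI _ _ _ h
    refine (Ev.loop_step (t := t) (t' := l.length * (t + 1) + 1) (by rw [hk]; exact hp v x) ?_).mono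
      (by simp only [List.length_cons, add_mul]; omega)
    rw [hk]
    exact hstep x l v S h _ fun v' S' h' => ih h'

variable {W : Memory}

/-- Pops from a working stack into the register. -/
def popW (k : WorkStack) : Chart (work.prod W) :=
  pop (.inl k) fun v s => ({ v.1 with r := s }, v.2)

/-- Pushes onto a working stack. -/
def pushW (k : WorkStack) (f : Reg → Bool) : Chart (work.prod W) :=
  push (.inl k) fun v => f v.1

/-- Changes the register and the flags. -/
def loadW (f : Reg → Reg) : Chart (work.prod W) := load fun v => (f v.1, v.2)

/-- Pops from a working stack into the register, and executes a chart and repeats as long as `p`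
holds. -/
def loopW (k : WorkStack) (p : Reg → Bool) (G : Chart (work.prod W)) : Chart (work.prod W) :=
  loop (.inl k) (fun v s => ({ v.1 with r := s }, v.2)) (fun v => p v.1) G

/-- Executes a chart for every symbol of a working stack. -/
def eachW (k : WorkStack) (G : Chart (work.prod W)) : Chart (work.prod W) :=
  loopW k (fun ρ => ρ.r.isSome) G

/-- Pushes onto a stack of the right memory. -/
def pushR (k : W.K) (f : Reg → W.Γ k) : Chart (work.prod W) :=
  push (.inr k) fun v => f v.1

/-- Executes a chart for every symbol of a stack of the right memory, read through `e`. -/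
def eachR (k : W.K) (e : W.Γ k → Bool) (G : Chart (work.prod W)) : Chart (work.prod W) :=
  loop (.inr k) (fun v s => ({ v.1 with r := s.map e }, v.2)) (fun v => v.1.r.isSome) G

variable {G : Chart (work.prod W)} {Q : (work.prod W).σ → (work.prod W).Stk → ℤ → Prop} {t : ℕ}
  {ρ : Reg} {v : W.σ} {S : work.Stk} {S' : W.Stk} {w : ℤ}

theorem Ev.popW {k : WorkStack}
    (h : Q ({ ρ with r := (S k).head? }, v) (Memory.join (Function.update S k (S k).tail) S') w) :
    (Chart.popW k).Ev (ρ, v) (Memory.join S S') 1 Q w :=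
  Ev.pop (by rw [Memory.update_join_inl]; exact h)

theorem Ev.pushW {k : WorkStack} {f : Reg → Bool}
    (h : Q (ρ, v) (Memory.join (Function.update S k (f ρ :: S k)) S') w) :
    (Chart.pushW k f).Ev (ρ, v) (Memory.join S S') 1 Q w :=
  Ev.push (by rw [Memory.update_join_inl]; exact h)

theorem Ev.pushR {k : W.K} {f : Reg → W.Γ k}
    (h : Q (ρ, v) (Memory.join S (Function.update S' k (f ρ :: S' k))) w) :
    (Chart.pushR k f).Ev (ρ, v) (Memory.join S S') 1 Q w :=
  Ev.push (by rw [Memory.update_join_inr]; exact h)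

theorem Ev.loadW {f : Reg → Reg} (h : Q (f ρ, v) (Memory.join S S') w) :
    (Chart.loadW f).Ev (ρ, v) (Memory.join S S') 1 Q w :=
  Ev.load h

theorem Ev.loopW_exit {k : WorkStack} {p : Reg → Bool}
    (hp : p { ρ with r := (S k).head? } = false)
    (h : Q ({ ρ with r := (S k).head? }, v) (Memory.join (Function.update S k (S k).tail) S') w) :
    (Chart.loopW k p G).Ev (ρ, v) (Memory.join S S') 1 Q w :=
  Ev.loop_exit (W := work.prod W) hp (by rw [Memory.update_join_inl]; exact h)

theorem Ev.loopW_step {k : WorkStack} {p : Reg → Bool} {t' : ℕ}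
    (hp : p { ρ with r := (S k).head? } = true)
    (h : G.Ev ({ ρ with r := (S k).head? }, v) (Memory.join (Function.update S k (S k).tail) S') t
      (fun v S w => (Chart.loopW k p G).Ev v S t' Q w) w) :
    (Chart.loopW k p G).Ev (ρ, v) (Memory.join S S') (t + t' + 1) Q w :=
  Ev.loop_step (W := work.prod W) hp (by rw [Memory.update_join_inl]; exact h)

theorem Ev.eachW {k : WorkStack} (I : List Bool → Reg → W.σ → work.Stk → W.Stk → Prop)
    (hI : ∀ l ρ v S S', I l ρ v S S' → S k = l)
    (hstep : ∀ x l ρ v S S', I (x :: l) ρ v S S' →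
      ∀ Q : (work.prod W).σ → (work.prod W).Stk → ℤ → Prop,
      (∀ ρ' v' S₁ S₁', I l ρ' v' S₁ S₁' → Q (ρ', v') (Memory.join S₁ S₁') w) →
        G.Ev ({ ρ with r := some x }, v) (Memory.join (Function.update S k l) S') t Q w)
    (l : List Bool) (h : I l ρ v S S')
    (hexit : ∀ ρ v S S', I [] ρ v S S' →
      Q ({ ρ with r := none }, v) (Memory.join (Function.update S k []) S') w) :
    (Chart.eachW k G).Ev (ρ, v) (Memory.join S S') (l.length * (t + 1) + 1) Q w := by
  refine Ev.each (W := work.prod W) (k := .inl k)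
    (fun l v S => ∃ S₁ S₁', S = Memory.join S₁ S₁' ∧ I l v.1 v.2 S₁ S₁')
    ?_ (fun _ _ => rfl) (fun _ => rfl) ?_ l ⟨S, S', rfl, h⟩ ?_
  · rintro l v _ ⟨S, S', rfl, h⟩
    exact hI _ _ _ _ _ h
  · rintro x l v _ ⟨S, S', rfl, h⟩ Q hQ
    rw [Memory.update_join_inl]
    exact hstep x l _ _ _ _ h Q fun ρ' v' S₁ S₁' h => hQ _ _ ⟨_, _, rfl, h⟩
  · rintro v _ ⟨S, S', rfl, h⟩
    rw [Memory.update_join_inl]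
    exact hexit _ _ _ _ h

theorem Ev.eachR {k : W.K} {e : W.Γ k → Bool}
    (I : List (W.Γ k) → Reg → W.σ → work.Stk → W.Stk → Prop)
    (hI : ∀ l ρ v S S', I l ρ v S S' → S' k = l)
    (hstep : ∀ x l ρ v S S', I (x :: l) ρ v S S' →
      ∀ Q : (work.prod W).σ → (work.prod W).Stk → ℤ → Prop,
      (∀ ρ' v' S₁ S₁', I l ρ' v' S₁ S₁' → Q (ρ', v') (Memory.join S₁ S₁') w) →
        G.Ev ({ ρ with r := some (e x) }, v) (Memory.join S (Function.update S' k l)) t Q w)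
    (l : List (W.Γ k)) (h : I l ρ v S S')
    (hexit : ∀ ρ v S S', I [] ρ v S S' →
      Q ({ ρ with r := none }, v) (Memory.join S (Function.update S' k [])) w) :
    (Chart.eachR k e G).Ev (ρ, v) (Memory.join S S') (l.length * (t + 1) + 1) Q w := by
  refine Ev.each (W := work.prod W) (k := .inr k)
    (fun l v S => ∃ S₁ S₁', S = Memory.join S₁ S₁' ∧ I l v.1 v.2 S₁ S₁')
    ?_ (fun _ _ => rfl) (fun _ => rfl) ?_ l ⟨S, S', rfl, h⟩ ?_
  · rintro l v _ ⟨S, S', rfl, h⟩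
    exact hI _ _ _ _ _ h
  · rintro x l v _ ⟨S, S', rfl, h⟩ Q hQ
    rw [Memory.update_join_inr]
    exact hstep x l _ _ _ _ h Q fun ρ' v' S₁ S₁' h => hQ _ _ ⟨_, _, rfl, h⟩
  · rintro v _ ⟨S, S', rfl, h⟩
    rw [Memory.update_join_inr]
    exact hexit _ _ _ _ h

/-- Moves the content of a working stack to another one, where it appears reversed. -/
def moveW (j k : WorkStack) (φ : Bool → Bool) : Chart (work.prod W) :=
  eachW j (pushW k fun ρ => φ ρ.bit)

theorem Ev.moveW {j k : WorkStack} (hjk : j ≠ k) {φ : Bool → Bool}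
    (h : Q ({ ρ with r := none }, v) (Memory.join (Function.update
      (Function.update S k (((S j).map φ).reverse ++ S k)) j []) S') w) :
    (Chart.moveW j k φ).Ev (ρ, v) (Memory.join S S') ((S j).length * 2 + 1) Q w := by
  -- The invariant: `l` remains and the prefix `l'` has been moved. The register is fixed only up to
  -- its symbol, which every round overwrites.
  refine Ev.eachW (t := 1) (fun l ρ₁ v₁ S₁ S₁' => v₁ = v ∧ S₁' = S' ∧
    { ρ₁ with r := none } = { ρ with r := none } ∧ ∃ l', S j = l' ++ l ∧ S₁ = Function.update
      (Function.update S k ((l'.map φ).reverse ++ S k)) j l) ?_ ?_ (S j) ?_ ?_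
  · rintro l ρ v S₁ S' ⟨-, -, -, l', -, rfl⟩
    simp
  · rintro x l ρ₁ v₁ S₁ S₁' ⟨rfl, rfl, hρ, l', hl, rfl⟩ Q hQ
    refine Ev.pushW (hQ _ _ _ _ ⟨rfl, rfl, hρ, l' ++ [x], by simp [hl], ?_⟩)
    rw [Function.update_idem, Function.update_of_ne hjk.symm, Function.update_self,
      Function.update_comm hjk.symm, Function.update_idem]
    simpa [Reg.bit] using Function.update_comm hjk _ _ S
  · exact ⟨rfl, rfl, rfl, [], rfl, by
      rw [List.map_nil, List.reverse_nil, List.nil_append, Function.update_eq_self,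
        Function.update_eq_self]⟩
  · rintro ρ₁ v₁ S₁ S₁' ⟨rfl, rfl, hρ, l', hl, rfl⟩
    rw [hρ, Function.update_idem]
    rw [List.append_nil] at hl
    rwa [← hl]

/-- Moves the content of a working stack to a stack of the right memory, where it appears
reversed. -/
def moveOut (j : WorkStack) (k : W.K) (φ : Bool → W.Γ k) : Chart (work.prod W) :=
  eachW j (pushR k fun ρ => φ ρ.bit)

theorem Ev.moveOut {j : WorkStack} {k : W.K} {φ : Bool → W.Γ k}
    (h : Q ({ ρ with r := none }, v) (Memory.join (Function.update S j [])
      (Function.update S' k (((S j).map φ).reverse ++ S' k))) w) :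
    (Chart.moveOut j k φ).Ev (ρ, v) (Memory.join S S') ((S j).length * 2 + 1) Q w := by
  refine Ev.eachW (t := 1) (fun l ρ₁ v₁ S₁ S₁' => v₁ = v ∧
    { ρ₁ with r := none } = { ρ with r := none } ∧ ∃ l', S j = l' ++ l ∧ S₁ = Function.update S j l ∧
      S₁' = Function.update S' k ((l'.map φ).reverse ++ S' k)) ?_ ?_ (S j) ?_ ?_
  · rintro l ρ v S₁ S' ⟨-, -, l', -, rfl, -⟩
    simp
  · rintro x l ρ₁ v₁ S₁ S₁' ⟨rfl, hρ, l', hl, rfl, rfl⟩ Q hQ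
    refine Ev.pushR (hQ _ _ _ _ ⟨rfl, hρ, l' ++ [x], by simp [hl], ?_, ?_⟩)
    · rw [Function.update_idem]
    · rw [Function.update_idem, Function.update_self]
      simp [Reg.bit]
  · exact ⟨rfl, rfl, [], rfl, by rw [Function.update_eq_self], by
      rw [List.map_nil, List.reverse_nil, List.nil_append, Function.update_eq_self]⟩
  · rintro ρ₁ v₁ S₁ S₁' ⟨rfl, hρ, l', hl, rfl, rfl⟩
    rw [hρ, Function.update_idem]
    rw [List.append_nil] at hl
    rwa [← hl]

/-- Moves the content of a stack of the right memory to a working stack, where it appears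
reversed. -/
def moveIn (k : W.K) (e : W.Γ k → Bool) (j : WorkStack) : Chart (work.prod W) :=
  eachR k e (pushW j Reg.bit)

theorem Ev.moveIn {j : WorkStack} {k : W.K} {e : W.Γ k → Bool}
    (h : Q ({ ρ with r := none }, v) (Memory.join
      (Function.update S j (((S' k).map e).reverse ++ S j)) (Function.update S' k [])) w) :
    (Chart.moveIn k e j).Ev (ρ, v) (Memory.join S S') ((S' k).length * 2 + 1) Q w := by
  refine Ev.eachR (t := 1) (fun l ρ₁ v₁ S₁ S₁' => v₁ = v ∧
    { ρ₁ with r := none } = { ρ with r := none } ∧ ∃ l', S' k = l' ++ l ∧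
      S₁ = Function.update S j ((l'.map e).reverse ++ S j) ∧ S₁' = Function.update S' k l)
    ?_ ?_ (S' k) ?_ ?_
  · rintro l ρ v S₁ S' ⟨-, -, l', -, -, rfl⟩
    simp
  · rintro x l ρ₁ v₁ S₁ S₁' ⟨rfl, hρ, l', hl, rfl, rfl⟩ Q hQ
    refine Ev.pushW (hQ _ _ _ _ ⟨rfl, hρ, l' ++ [x], by simp [hl], ?_, ?_⟩)
    · rw [Function.update_idem, Function.update_self]
      simp [Reg.bit]
    · rw [Function.update_idem]
  · exact ⟨rfl, rfl, [], rfl, by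
      rw [List.map_nil, List.reverse_nil, List.nil_append, Function.update_eq_self],
      by rw [Function.update_eq_self]⟩
  · rintro ρ₁ v₁ S₁ S₁' ⟨rfl, hρ, l', hl, rfl, rfl⟩
    rw [hρ, Function.update_idem]
    rw [List.append_nil] at hl
    rwa [← hl]

/-- Empties some stacks of the right memory. -/
def clear : List W.K → Chart (work.prod W)
  | [] => loadW fun ρ => { ρ with r := none }
  | k :: ks => eachR k (fun _ => false) (loadW id) ⨟ clear ks

theorem Ev.clear (B : ℕ) (ks : List W.K) (hB : ∀ k ∈ ks, (S' k).length ≤ B)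
    (h : Q ({ ρ with r := none }, v) (Memory.join S fun k => if k ∈ ks then [] else S' k) w) :
    (Chart.clear ks).Ev (ρ, v) (Memory.join S S') (ks.length * (B * 2 + 1) + 1) Q w := by
  induction ks generalizing S' ρ with
  | nil => exact (Ev.loadW (by simpa using h)).mono (by simp)
  | cons k ks ih =>
    have key : (Chart.eachR k (fun _ => false) (Chart.loadW id)).Ev (ρ, v) (Memory.join S S')
        ((S' k).length * (1 + 1) + 1)
        (fun v S w => (Chart.clear ks).Ev v S (ks.length * (B * 2 + 1) + 1) Q w) w := by
      refine Ev.eachR (t := 1) (fun l ρ₁ v₁ S₁ S₁' => v₁ = v ∧ S₁ = S ∧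
        { ρ₁ with r := none } = { ρ with r := none } ∧ S₁' = Function.update S' k l)
        ?_ ?_ (S' k) ?_ ?_
      · rintro l ρ v S₁ S' ⟨-, -, -, rfl⟩
        simp
      · rintro x l ρ₁ v₁ S₁ S₁' ⟨rfl, rfl, hρ, rfl⟩ Q hQ
        exact Ev.loadW (hQ _ _ _ _ ⟨rfl, rfl, hρ, by rw [Function.update_idem]⟩)
      · exact ⟨rfl, rfl, rfl, by rw [Function.update_eq_self]⟩
      · rintro ρ₁ v₁ S₁ S₁' ⟨rfl, rfl, hρ, rfl⟩
        rw [hρ, Function.update_idem]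
        refine ih (fun j hj' => ?_) ?_
        · by_cases hj : j = k
          · subst hj; simp
          · simpa [hj] using hB j (by simp [hj'])
        · convert h using 3 with j
          by_cases hj : j = k
          · subst hj; simp
          · simp [hj]
    refine (Ev.seq key).mono ?_
    have := hB k (by simp)
    simp only [List.length_cons, add_mul]
    omega

end Chart

/-! ### Unary arithmetic and the polynomial clock -/

theorem zeros_append (m n : ℕ) : zeros m ++ zeros n = zeros (m + n) := by simp [zeros]

@[simp] theorem reverse_zeros (n : ℕ) : (zeros n).reverse = zeros n := by simp [zeros]

@[simp] theorem length_zeros (n : ℕ) : (zeros n).length = n := by simp [zeros]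

theorem zeros_succ (n : ℕ) : zeros (n + 1) = false :: zeros n := rfl

namespace Chart

variable {W : Memory} {Q : (work.prod W).σ → (work.prod W).Stk → ℤ → Prop} {t : ℕ}
  {ρ : Reg} {v : W.σ} {S : work.Stk} {S' : W.Stk} {w : ℤ}

/-- Moves the content of `j` to `k`, where it appears reversed, and pushes as many zeros
onto `m`. -/
def copyW (j k m : WorkStack) : Chart (work.prod W) :=
  eachW j (pushW k Reg.bit ⨟ pushW m fun _ => false)

theorem Ev.copyW {j k m : WorkStack} (hjk : j ≠ k) (hjm : j ≠ m) (hkm : k ≠ m)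
    (h : Q ({ ρ with r := none }, v) (Memory.join (Function.update (Function.update
      (Function.update S m (zeros (S j).length ++ S m)) k ((S j).reverse ++ S k)) j []) S') w) :
    (Chart.copyW j k m).Ev (ρ, v) (Memory.join S S') ((S j).length * 3 + 1) Q w := by
  refine Ev.eachW (t := 1 + 1) (fun l ρ₁ v₁ S₁ S₁' => v₁ = v ∧ S₁' = S' ∧
    { ρ₁ with r := none } = { ρ with r := none } ∧ ∃ l', S j = l' ++ l ∧ S₁ = Function.update
      (Function.update (Function.update S m (zeros l'.length ++ S m)) k (l'.reverse ++ S k)) j l)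
    ?_ ?_ (S j) ?_ ?_
  · rintro l ρ v S₁ S' ⟨-, -, -, l', -, rfl⟩
    simp
  · rintro x l ρ₁ v₁ S₁ S₁' ⟨rfl, rfl, hρ, l', hl, rfl⟩ Q hQ
    refine Ev.seq (Ev.pushW (Ev.pushW (hQ _ _ _ _
      ⟨rfl, rfl, hρ, l' ++ [x], by simp [hl], ?_⟩)))
    funext i
    by_cases hij : i = j
    · subst hij; simp [hjk, hjm]
    · by_cases hik : i = k
      · subst hik; simp [hjk.symm, hkm]
      · by_cases him : i = m
        · subst him; simp [hjm.symm, hkm.symm, zeros_succ]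
        · simp [hij, hik, him]
  · exact ⟨rfl, rfl, rfl, [], rfl, by simp [zeros]⟩
  · rintro ρ₁ v₁ S₁ S₁' ⟨rfl, rfl, hρ, l', hl, rfl⟩
    rw [hρ, Function.update_idem]
    rw [List.append_nil] at hl
    rwa [← hl]

/-- Pushes `n` zeros. -/
def pushZeros (k : WorkStack) : ℕ → Chart (work.prod W)
  | 0 => loadW id
  | n + 1 => pushW k (fun _ => false) ⨟ pushZeros k n

theorem Ev.pushZeros {k : WorkStack} {n : ℕ}
    (h : Q (ρ, v) (Memory.join (Function.update S k (zeros n ++ S k)) S') w) :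
    (Chart.pushZeros k n).Ev (ρ, v) (Memory.join S S') (n + 1) Q w := by
  induction n generalizing S with
  | zero => exact Ev.loadW (by simpa [zeros] using h)
  | succ n ih =>
    refine (Ev.seq (Ev.pushW (ih ?_))).mono (t := 1 + (n + 1)) (by omega)
    rw [Function.update_idem, Function.update_self]
    convert h using 3
    rw [← zeros_append n 1]
    simp [zeros]

/-- Multiplies the length of `P` by that of `U`. -/
def mulPU : Chart (work.prod W) :=
  moveW .P .R id ⨟ eachW .R (copyW .U .T .P ⨟ moveW .T .U id)

/-- The `m` zeros are moved to `R`; each of them then triggers one pass over `U` that adds `n` zeros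
to `P` and restores `U`. After `i` rounds `P` holds `i * n` zeros. -/
theorem Ev.mulPU {x c : List Bool} {m n : ℕ}
    (h : Q ({ ρ with r := none }, v)
      (Memory.join (wstk x [] (zeros (m * n)) [] (zeros n) c) S') w) :
    Chart.mulPU.Ev (ρ, v) (Memory.join (wstk x [] (zeros m) [] (zeros n) c) S')
      ((m * 2 + 1) + (m * ((n * 3 + 1) + (n * 2 + 1) + 1) + 1)) Q w := by
  have := Ev.seq (W := work.prod W) (t' := m * ((n * 3 + 1) + (n * 2 + 1) + 1) + 1)
    (Q := Q) (w := w) (H := Chart.eachW .R (Chart.copyW .U .T .P ⨟ Chart.moveW .T .U id))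
    (Ev.moveW (j := .P) (k := .R) (by decide) (φ := id) (ρ := ρ) (v := v)
      (S := wstk x [] (zeros m) [] (zeros n) c) (S' := S') ?_)
  · simpa [Chart.mulPU] using this
  simp only [wstk_P, wstk_R, update_wstk_P, update_wstk_R, List.map_id, reverse_zeros,
    List.append_nil]
  have key := Ev.eachW (W := W) (k := .R) (ρ := { ρ with r := none }) (v := v)
    (S := wstk x [] [] (zeros m) (zeros n) c) (S' := S') (w := w) (Q := Q)
    (G := Chart.copyW .U .T .P ⨟ Chart.moveW .T .U id) (t := (n * 3 + 1) + (n * 2 + 1))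
    (fun l ρ₁ v₁ S₁ S₁' => v₁ = v ∧ S₁' = S' ∧ { ρ₁ with r := none } = { ρ with r := none } ∧
      ∃ i, l.length + i = m ∧ S₁ = wstk x [] (zeros (i * n)) l (zeros n) c)
    ?_ ?_ (zeros m) ?_ ?_
  · simpa using key
  · rintro l ρ v S₁ S' ⟨-, -, -, i, -, rfl⟩
    rfl
  · rintro b l ρ₁ v₁ S₁ S₁' ⟨rfl, rfl, hρ, i, hl, rfl⟩ Q hQ
    have h₁ := Ev.seq (W := work.prod W) (t' := n * 2 + 1) (Q := Q) (w := w)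
      (H := Chart.moveW .T .U id)
      (Ev.copyW (j := .U) (k := .T) (m := .P) (by decide) (by decide) (by decide)
        (ρ := { ρ₁ with r := some b }) (v := v₁)
        (S := Function.update (wstk x [] (zeros (i * n)) (b :: l) (zeros n) c) .R l)
        (S' := S₁') ?_)
    · simpa using h₁
    simp only [update_wstk_R, wstk_U, wstk_T, wstk_P, update_wstk_U, update_wstk_T, update_wstk_P,
      length_zeros, reverse_zeros, List.append_nil, zeros_append]
    have h₂ := Ev.moveW (W := W) (j := .T) (k := .U) (by decide) (φ := id)
      (ρ := { ρ₁ with r := none }) (v := v₁) (Q := Q) (w := w)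
      (S := wstk x (zeros n) (zeros (n + i * n)) l [] c) (S' := S₁')
      (hQ _ _ _ _ ⟨rfl, rfl, hρ, i + 1, by rw [← hl]; simp; omega, by
        simp [add_mul, add_comm]⟩)
    simpa using h₂
  · exact ⟨rfl, rfl, rfl, 0, by simp, by simp [zeros]⟩
  · rintro ρ₁ v₁ S₁ S₁' ⟨rfl, rfl, hρ, i, hl, rfl⟩
    rw [hρ]
    simp only [List.length_nil, zero_add] at hl
    subst hl
    simpa using h

/-- Pushes `(n + c) ^ k` zeros onto `P` and `n + c` zeros onto `U`, where `n` is the length of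
the content of `X`. -/
def clock (c : ℕ) : ℕ → Chart (work.prod W)
  | 0 => copyW .X .T .U ⨟ pushZeros .U c ⨟ moveW .T .X id ⨟ pushW .P (fun _ => false)
  | k + 1 => clock c k ⨟ mulPU

/-- `P` starts with one zero and is multiplied `k` times by the length of `U`. The time bound is
chosen before the second memory, so it does not depend on what the clock is combined with. -/
theorem exists_ev_clock (c k : ℕ) : ∃ T : ℕ → ℕ, PolyBdd T ∧ ∀ (W : Memory)
    (Q : (work.prod W).σ → (work.prod W).Stk → ℤ → Prop) (ρ v S' w) (x d : List Bool),
    Q ({ ρ with r := none }, v) (Memory.join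
      (wstk x [] (zeros ((x.length + c) ^ k)) [] (zeros (x.length + c)) d) S') w →
    (clock c k).Ev (ρ, v) (Memory.join (wstk x [] [] [] [] d) S') (T x.length) Q w := by
  induction k with
  | zero =>
    refine ⟨fun n => (n * 3 + 1) + ((c + 1) + ((n * 2 + 1) + 1)), ?_, fun W Q ρ v S' w x d h => ?_⟩
    · exact .add (.add (.mul .id (.const _)) (.const _)) (.add (.const _)
        (.add (.add (.mul .id (.const _)) (.const _)) (.const _)))
    refine Ev.seq (Ev.copyW (by decide) (by decide) (by decide) ?_)
    refine Ev.seq (Ev.pushZeros ?_)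
    simp only [wstk_X, wstk_U, wstk_T, update_wstk_X, update_wstk_U, update_wstk_T,
      List.append_nil, zeros_append]
    have key := Ev.moveW (W := W) (j := .T) (k := .X) (φ := id) (ρ := { ρ with r := none })
      (v := v) (S := wstk [] x.reverse [] [] (zeros (c + x.length)) d) (S' := S')
      (w := w) (by decide)
      (Q := fun v S w => (Chart.pushW .P fun _ => false).Ev v S 1 Q w) (Ev.pushW (by
        simpa [add_comm c, zeros_succ, zeros] using h))
    have := Ev.seq key
    simpa using this
  | succ k ih =>
    obtain ⟨T, hT, ih⟩ := ih
    refine ⟨fun n => T n + (((n + c) ^ k * 2 + 1) + ((n + c) ^ k *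
      (((n + c) * 3 + 1) + ((n + c) * 2 + 1) + 1) + 1)), ?_, fun W Q ρ v S' w x d h => ?_⟩
    · have h₁ : PolyBdd fun n => n + c := .add .id (.const _)
      exact .add hT (.add (.add (.mul (h₁.pow _) (.const _)) (.const _)) (.add (.mul (h₁.pow _)
        (.add (.add (.add (.mul h₁ (.const _)) (.const _)) (.add (.mul h₁ (.const _)) (.const _)))
          (.const _))) (.const _)))
    · exact Ev.seq (ih _ _ _ _ _ _ _ _ (Ev.mulPU (by rwa [pow_succ] at h)))

end Chart

/-! ## Some polynomial-time computable functions -/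

theorem exists_bits_eq_append (l : List Bool) : ∃ n : ℕ, n ≠ 0 ∧ n.bits = l ++ [true] := by
  induction l with
  | nil => exact ⟨1, one_ne_zero, Nat.one_bits⟩
  | cons b l ih =>
    obtain ⟨n, hn, h⟩ := ih
    exact ⟨Nat.bit b n, fun h0 => hn (Nat.bit_eq_zero_iff.1 h0).1, by
      rw [Nat.bits_append_bit _ _ fun h0 => absurd h0 hn, h, List.cons_append]⟩

theorem exists_eq_append_bits {n : ℕ} (hn : n ≠ 0) : ∃ l, n.bits = l ++ [true] := by
  induction n using Nat.binaryRec' with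
  | zero => exact absurd rfl hn
  | bit b n hb ih =>
    rw [Nat.bits_append_bit _ _ hb]
    by_cases h0 : n = 0
    · subst h0
      exact ⟨[], by simp [hb rfl]⟩
    · obtain ⟨l, hl⟩ := ih h0
      exact ⟨b :: l, by rw [hl, List.cons_append]⟩

theorem bits_two_pow (m : ℕ) : (2 ^ m).bits = zeros m ++ [true] := by
  induction m with
  | zero => exact Nat.one_bits
  | succ m ih =>
    rw [pow_succ', Nat.bit0_bits _ (by positivity), ih]
    rfl

/-- The positive number with binary digits `l`, followed by the digit `1`. -/
noncomputable def ofBits (l : List Bool) : ℕ := (exists_bits_eq_append l).choose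

theorem ofBits_ne_zero (l : List Bool) : ofBits l ≠ 0 := (exists_bits_eq_append l).choose_spec.1

theorem bits_ofBits (l : List Bool) : (ofBits l).bits = l ++ [true] :=
  (exists_bits_eq_append l).choose_spec.2

theorem bits_injective {m n : ℕ} (h : m.bits = n.bits) : m = n := by
  have key : ∀ n : ℕ, n.bits.foldr Nat.bit 0 = n := fun n => by
    induction n using Nat.binaryRec' with
    | zero => simp
    | bit b n hb ih => rw [Nat.bits_append_bit _ _ hb, List.foldr_cons, ih]
  rw [← key m, ← key n, h]

/-- The integer with sign `b` and with the binary digits `l`, where the last digit is replaced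
by `1`. -/
noncomputable def signedBits (b : Bool) (l : List Bool) : ℤ :=
  if b then -(ofBits l.dropLast : ℤ) else ofBits l.dropLast

/-- The last digit is the leading one, and it is forced to be `1`. The definition of `r`-LWPP needs
a nonzero target at every index `i ≥ 1`, also at those that no input uses. -/
theorem signedBits_ne_zero (b : Bool) (l : List Bool) : signedBits b l ≠ 0 := by
  have := ofBits_ne_zero l.dropLast
  cases b <;> simp [signedBits, this]

theorem encodeInt_signedBits (b : Bool) (l : List Bool) :
    encodeInt (signedBits b l) = b :: (l.dropLast ++ [true]) := by
  have := Nat.pos_of_ne_zero (ofBits_ne_zero l.dropLast)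
  cases b <;> simp [signedBits, encodeInt, bits_ofBits, this]

/-- The leading digit of a nonzero number is already `1`, so forcing it changes nothing; hence every
nonzero integer is attained as a target. -/
theorem signedBits_bits {z : ℤ} (hz : z ≠ 0) : signedBits (decide (z < 0)) z.natAbs.bits = z := by
  have h : ofBits z.natAbs.bits.dropLast = z.natAbs := by
    refine bits_injective ?_
    obtain ⟨l, hl⟩ := exists_eq_append_bits (Int.natAbs_ne_zero.2 hz)
    rw [bits_ofBits, hl, List.dropLast_concat]
  rw [signedBits, h]
  split_ifs with h' <;> simp at h' <;> omega

/-- Removes the first component of a pair. -/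
def stripFst : List Bool → List Bool
  | true :: _ :: l => stripFst l
  | [true] => []
  | false :: l => l
  | [] => []

theorem stripFst_pair (x y : List Bool) : stripFst (pair x y) = y := by
  induction x with
  | nil => rfl
  | cons b x ih => exact ih

/-- The memory without stacks. -/
@[reducible] def noMemory : Memory where
  K := Empty
  Γ _ := Unit
  σ := Unit

namespace Chart

variable {W : Memory} {Q : (work.prod W).σ → (work.prod W).Stk → ℤ → Prop} {t : ℕ}
  {ρ : Reg} {v : W.σ} {S : work.Stk} {S' : W.Stk} {w : ℤ}

/-- Empties a working stack. -/
def clearW (k : WorkStack) : Chart (work.prod W) := eachW k (loadW id)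

theorem Ev.clearW {k : WorkStack}
    (h : Q ({ ρ with r := none }, v) (Memory.join (Function.update S k []) S') w) :
    (Chart.clearW k).Ev (ρ, v) (Memory.join S S') ((S k).length * 2 + 1) Q w := by
  refine Ev.eachW (t := 1) (fun l ρ₁ v₁ S₁ S₁' => v₁ = v ∧ S₁' = S' ∧
    { ρ₁ with r := none } = { ρ with r := none } ∧ S₁ = Function.update S k l) ?_ ?_ (S k) ?_ ?_
  · rintro l ρ v S₁ S' ⟨-, -, -, rfl⟩
    simp
  · rintro x l ρ₁ v₁ S₁ S₁' ⟨rfl, rfl, hρ, rfl⟩ Q hQ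
    exact Ev.loadW (hQ _ _ _ _ ⟨rfl, rfl, hρ, by rw [Function.update_idem]⟩)
  · exact ⟨rfl, rfl, rfl, by rw [Function.update_eq_self]⟩
  · rintro ρ₁ v₁ S₁ S₁' ⟨rfl, rfl, hρ, rfl⟩
    rw [hρ, Function.update_idem]
    exact h

/-- Replaces the content `x` of `X` by `stripFst x`. -/
def stripX : Chart (work.prod W) := loopW .X Reg.bit (popW .X)

theorem Ev.stripX (x : List Bool) {t p r u c : List Bool}
    (h : ∀ b, Q ({ ρ with r := b }, v) (Memory.join (wstk (stripFst x) t p r u c) S') w) :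
    Chart.stripX.Ev (ρ, v) (Memory.join (wstk x t p r u c) S') (x.length * 2 + 1) Q w := by
  induction x using stripFst.induct generalizing ρ with
  | case1 b l ih =>
    refine (Ev.loopW_step (t := 1) rfl ?_).mono (t := 1 + (l.length * 2 + 1) + 1)
      (by simp only [List.length_cons]; omega)
    simp only [wstk_X, List.tail_cons, update_wstk_X]
    refine Ev.popW ?_
    simp only [wstk_X, List.tail_cons, update_wstk_X]
    exact ih h
  | case2 =>
    refine (Ev.loopW_step (t := 1) (t' := 1) rfl ?_).mono (by simp)
    simp only [wstk_X, List.tail_cons, update_wstk_X]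
    refine Ev.popW ?_
    simp only [wstk_X, List.tail_nil, update_wstk_X]
    -- An empty stack is read as `none`, whose `bit` is `false` by default, and this ends the loop.
    refine Ev.loopW_exit rfl ?_
    simp only [wstk_X, List.tail_nil, update_wstk_X]
    exact h _
  | case3 l =>
    refine (Ev.loopW_exit rfl ?_).mono (by simp)
    simp only [wstk_X, List.tail_cons, update_wstk_X]
    exact h _
  | case4 =>
    refine (Ev.loopW_exit rfl ?_).mono (by simp)
    simp only [wstk_X, List.tail_nil, update_wstk_X]
    exact h _

end Chart

open Chart

/-- Computability in polynomial time by a flow chart on the working stacks. -/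
theorem mem_FP_of_work (G : Chart (work.prod noMemory)) {f : List Bool → ℤ} {T : ℕ → ℕ}
    (hT : PolyBdd T)
    (h : ∀ x (Q : (work.prod noMemory).σ → (work.prod noMemory).Stk → ℤ → Prop),
      Q (⟨none, false, false⟩, ()) (Memory.join (wstk [] [] [] [] [] (encodeInt (f x)))
        (fun _ => [])) 1 →
      G.Ev (⟨none, false, false⟩, ()) (Memory.join (wstk x [] [] [] [] []) (fun _ => []))
        (T x.length) Q 1) :
    f ∈ FP := by
  refine mem_FP (W := work.prod noMemory) G (k₀ := Sum.inl WorkStack.X) (k₁ := Sum.inl WorkStack.C) (Equiv.refl Bool)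
    (Equiv.refl Bool) (v₀ := (⟨none, false, false⟩, ())) hT fun x => ?_
  have := h x (fun v S w => v = (⟨none, false, false⟩, ()) ∧ S = Memory.single (W := work.prod noMemory) (.inl .C)
    ((encodeInt (f x)).map (Equiv.refl Bool).symm) ∧ w = 1) ⟨rfl, by
      rw [Equiv.refl_symm, Equiv.coe_refl, List.map_id]
      exact (single_C _).symm, rfl⟩
  rw [← single_X] at this
  rw [Equiv.refl_symm, Equiv.coe_refl, List.map_id]
  exact this

theorem zero_mem_FP : (fun _ => 0) ∈ FP := by
  refine mem_FP_of_work (clearW .X ⨟ pushW .C fun _ => false) (T := fun n => n * 2 + 1 + 1)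
    (.add (.add (.mul .id (.const _)) (.const _)) (.const _)) fun x Q hQ => ?_
  refine Ev.seq (Ev.clearW ?_)
  simp only [update_wstk_X]
  refine Ev.pushW ?_
  simpa [encodeInt] using hQ

/-- In binary, least significant digit first, `2 ^ m` is `m` zeros and a one. The unary clock is
therefore already the number, up to this last digit and the sign. -/
theorem two_pow_mem_FP (c k : ℕ) : (fun x => 2 ^ (x.length + c) ^ k) ∈ FP := by
  obtain ⟨T, hT, h⟩ := exists_ev_clock c k
  have hm : PolyBdd fun n => n + c := .add .id (.const _)
  refine mem_FP_of_work (clock c k ⨟ pushW .C (fun _ => true) ⨟ moveW .P .C id ⨟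
    pushW .C (fun _ => false) ⨟ clearW .X ⨟ clearW .U)
    (T := fun n => T n + (1 + (((n + c) ^ k * 2 + 1) + (1 + ((n * 2 + 1) + ((n + c) * 2 + 1))))))
    (.add hT (.add (.const _) (.add (.add (.mul (hm.pow _) (.const _)) (.const _)) (.add (.const _)
      (.add (.add (.mul .id (.const _)) (.const _)) (.add (.mul hm (.const _)) (.const _)))))))
    fun x Q hQ => ?_
  apply Ev.mono
  · apply Ev.seq
    apply h
    apply Ev.seq
    apply Ev.pushW
    simp only [update_wstk_C]
    apply Ev.seq
    apply Ev.moveW (by decide)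
    simp only [update_wstk_C, wstk_P, wstk_C, List.map_id, reverse_zeros, update_wstk_P]
    apply Ev.seq
    apply Ev.pushW
    simp only [update_wstk_C, wstk_C]
    apply Ev.seq
    apply Ev.clearW
    simp only [update_wstk_X]
    apply Ev.clearW
    simp only [update_wstk_U]
    have : encodeInt (2 ^ (x.length + c) ^ k) = false :: (zeros ((x.length + c) ^ k) ++ [true]) := by
      have h1 : ((2 : ℤ) ^ (x.length + c) ^ k).natAbs = 2 ^ (x.length + c) ^ k := by
        rw [Int.natAbs_pow]; rfl
      rw [encodeInt, h1, bits_two_pow]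
      congr 1
    rw [this] at hQ
    exact hQ
  · simp

/-- This is the target function for Exp-LWPP: after removal of `0ⁿ` from the pair, the first digit
of the index is the sign. On `T` the other digits are reversed, so one pop drops the leading digit,
and the `true` pushed first onto `C` replaces it. -/
theorem signedBits_mem_FP :
    (fun x => signedBits ((stripFst x).head?.getD false) (stripFst x).tail) ∈ FP := by
  refine mem_FP_of_work (stripX ⨟ popW .X ⨟ loadW (fun ρ => { ρ with a := ρ.bit }) ⨟
    moveW .X .T id ⨟ popW .T ⨟ pushW .C (fun _ => true) ⨟ moveW .T .C id ⨟
    pushW .C (fun ρ => ρ.a) ⨟ loadW fun _ => ⟨none, false, false⟩)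
    (T := fun n => n * 10 + 10) (.add (.mul .id (.const _)) (.const _)) fun x Q hQ => ?_
  apply Ev.mono
  · apply Ev.seq
    apply Ev.stripX
    intro b
    apply Ev.seq
    apply Ev.popW
    simp only [update_wstk_X]
    apply Ev.seq
    apply Ev.loadW
    apply Ev.seq
    apply Ev.moveW (by decide)
    simp only [update_wstk_X, wstk_X, wstk_T, List.map_id, update_wstk_T, List.append_nil]
    apply Ev.seq
    apply Ev.popW
    simp only [wstk_T, update_wstk_T]
    apply Ev.seq
    apply Ev.pushW
    simp only [wstk_C, update_wstk_C]
    apply Ev.seq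
    apply Ev.moveW (by decide)
    simp only [wstk_T, wstk_C, List.map_id, update_wstk_C, update_wstk_T]
    apply Ev.seq
    apply Ev.pushW
    simp only [wstk_C, update_wstk_C]
    apply Ev.loadW
    rw [encodeInt_signedBits] at hQ
    simpa [Reg.bit] using hQ
  · have : ∀ x : List Bool, (stripFst x).length ≤ x.length := fun x => by
      induction x using stripFst.induct with
      | case1 b l ih => exact ih.trans (by simp; omega)
      | _ => simp [stripFst]
    have := this x
    simp
    omega

theorem foldr_bits (n : ℕ) : n.bits.foldr Nat.bit 0 = n := by
  induction n using Nat.binaryRec' with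
  | zero => simp
  | bit b n hb ih => rw [Nat.bits_append_bit _ _ hb, List.foldr_cons, ih]

/-! ## Differences of counting functions and computable functions -/

/-- The initial contents of the register and the flags. -/
def reg₀ : Reg := ⟨none, false, false⟩

open Chart in
/-- Machines from flow charts that start with the input on `X` and accept by the flag `a`. -/
theorem exists_polyNTM_of_work {W : Memory} (G : Chart (work.prod W)) (v₀ : W.σ) (wt : Bool → ℤ)
    {g : List Bool → ℤ} {T : ℕ → ℕ} (hT : PolyBdd T)
    (h : ∀ x, G.Ev (reg₀, v₀) (Memory.join (wstk x [] [] [] [] []) (fun _ => [])) (T x.length)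
      (fun v _ w => w = wt v.1.a) (g x)) :
    ∃ N : PolyNTM, N.QueryFree ∧ ∀ x, g x = wt true * N.acc ∅ x + wt false * N.rej ∅ x := by
  refine exists_polyNTM (W := work.prod W) G (inp := Sum.inl WorkStack.X) (Equiv.refl Bool)
    (fun v => v.1.a) wt (v₀ := (reg₀, v₀)) hT fun x => ?_
  have := h x
  rw [← single_X] at this
  rw [Equiv.refl_symm, Equiv.coe_refl, List.map_id]
  exact this

theorem mem_GapP_of_work {W : Memory} (G : Chart (work.prod W)) (v₀ : W.σ)
    {g : List Bool → ℤ} {T : ℕ → ℕ} (hT : PolyBdd T)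
    (h : ∀ x, G.Ev (reg₀, v₀) (Memory.join (wstk x [] [] [] [] []) (fun _ => [])) (T x.length)
      (fun v _ w => w = if v.1.a then 1 else -1) (g x)) :
    g ∈ GapP := by
  obtain ⟨N, hN, e⟩ := exists_polyNTM_of_work G v₀ (fun b => if b then 1 else -1) hT h
  refine ⟨N, hN, fun x => ?_⟩
  rw [e, PolyNTM.gap]
  simp
  ring

namespace Chart

variable {W : Memory} {Q : (work.prod W).σ → (work.prod W).Stk → ℤ → Prop} {t : ℕ}
  {ρ : Reg} {v : W.σ} {S : work.Stk} {S' : W.Stk} {w : ℤ}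

/-- Sets the flag `a` nondeterministically. -/
def guessA : Chart (work.prod W) :=
  guess (loadW fun ρ => { ρ with a := true }) (loadW fun ρ => { ρ with a := false })

theorem Ev.guessA {w₁ w₂ : ℤ} (h₁ : Q ({ ρ with a := true }, v) (Memory.join S S') w₁)
    (h₂ : Q ({ ρ with a := false }, v) (Memory.join S S') w₂) :
    Chart.guessA.Ev (ρ, v) (Memory.join S S') 2 Q (w₁ + w₂) :=
  Ev.guess (Ev.loadW h₁) (Ev.loadW h₂)

/-- Branches on as many paths as the number on `R` says; these paths set the flag `a`. -/
def count : Chart (work.prod W) :=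
  eachW .R (ite (fun v => v.1.a) (loadW id) (ite (fun v => v.1.bit)
    (guess (loadW fun ρ => { ρ with a := true }) (guess (loadW id) (loadW id)))
    (guess (loadW id) (loadW id))))

/-- Horner's rule on digits with the lowest first: `b :: l` denotes `b` plus twice the value of `l`.
A digit `1` splits off one flagged path, which branches no more, and every digit doubles the
unflagged path. The flagged exits are as many as the number says; the unflagged ones must be given
the value `0`. -/
theorem Ev.count (d : ℤ) {a s : Bool} {l x t p u c : List Bool} {r : Option Bool}
    (h₁ : Q (⟨none, true, s⟩, v) (Memory.join (wstk x t p [] u c) S') d)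
    (h₀ : Q (⟨none, false, s⟩, v) (Memory.join (wstk x t p [] u c) S') 0) :
    Chart.count.Ev (⟨r, a, s⟩, v) (Memory.join (wstk x t p l u c) S') (l.length * 6 + 1) Q
      (if a then d else l.foldr Nat.bit 0 * d) := by
  induction l generalizing a r with
  | nil =>
    refine Ev.mono (t := 1) ?_ (by simp)
    unfold Chart.count Chart.eachW
    apply Ev.loopW_exit
    · rfl
    simp only [wstk_R, List.head?_nil, List.tail_nil, update_wstk_R]
    cases a
    · simpa using h₀
    · simpa using h₁
  | cons b l ih =>
    refine Ev.mono (t := 5 + (l.length * 6 + 1) + 1) ?_ (by simp only [List.length_cons]; omega)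
    unfold Chart.count Chart.eachW
    apply Ev.loopW_step
    · rfl
    simp only [wstk_R, List.head?_cons, List.tail_cons, update_wstk_R]
    have ih₀ : ∀ r, Chart.count.Ev (⟨r, false, s⟩, v) (Memory.join (wstk x t p l u c) S')
        (l.length * 6 + 1) Q (l.foldr Nat.bit 0 * d) := fun r => by simpa using @ih false r
    have ih₁ : ∀ r, Chart.count.Ev (⟨r, true, s⟩, v) (Memory.join (wstk x t p l u c) S')
        (l.length * 6 + 1) Q d := fun r => by simpa using @ih true r
    cases a
    · have h2 : ∀ r, (Chart.guess (Chart.loadW id) (Chart.loadW id)).Ev (⟨r, false, s⟩, v)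
          (Memory.join (wstk x t p l u c) S') 2
          (fun v S w => Chart.count.Ev v S (l.length * 6 + 1) Q w)
          (l.foldr Nat.bit 0 * d + l.foldr Nat.bit 0 * d) := fun r => by
        refine Ev.guess (t := 1) (t' := 1) ?_ ?_ <;>
        · apply Ev.loadW
          exact ih₀ r
      apply Ev.ite_false rfl
      cases b
      · apply Ev.ite_false rfl
        have hw : (if false = true then d else ((false :: l).foldr Nat.bit 0 : ℕ) * d) =
            l.foldr Nat.bit 0 * d + l.foldr Nat.bit 0 * d := by
          simp [Nat.bit_val]
          ring
        rw [hw]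
        exact (h2 _).mono (by omega)
      · apply Ev.ite_true rfl
        have hw : (if false = true then d else ((true :: l).foldr Nat.bit 0 : ℕ) * d) =
            d + (l.foldr Nat.bit 0 * d + l.foldr Nat.bit 0 * d) := by
          simp [Nat.bit_val]
          ring
        rw [hw]
        refine Ev.guess (t := 1) (t' := 2) ?_ (h2 _)
        apply Ev.loadW
        exact ih₁ _
    · apply Ev.ite_true rfl
      refine Ev.mono (t := 1) ?_ (by omega)
      apply Ev.loadW
      exact ih₁ _

end Chart

open Chart in
/-- The difference between a counting function and a function that is computable in polynomial
time, where rejecting paths are counted with weight `0` or `-1`. -/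
theorem sub_mem_GapP {N : PolyNTM} (hN : N.QueryFree) {f : List Bool → ℤ} (hf : f ∈ FP)
    (half : Bool) (φ : Bool → Bool) :
    (fun x => (N.acc ∅ x - (if half then 0 else 1) * N.rej ∅ x : ℤ) - f (x.map φ)) ∈ GapP := by
  obtain ⟨W₁, G₁, inp, e, v₁, acc, T₁, hT₁, h₁⟩ := exists_chart_of_polyNTM N hN
  obtain ⟨W₂, G₂, k₀, k₁, e₀, e₁, v₂, T₂, hT₂, h₂⟩ := exists_chart_of_FP hf
  refine mem_GapP_of_work (W := W₁.prod W₂) (v₀ := (v₁, v₂)) (guess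
    (moveW .X .T id ⨟ moveOut .T (.inl inp) e.symm ⨟ liftR (liftL G₁) ⨟
      ite (fun v => acc v.2.1) (loadW fun ρ => { ρ with a := true })
        (if half then guessA else loadW fun ρ => { ρ with a := false }))
    (moveW .X .T φ ⨟ moveOut .T (.inr k₀) e₀.symm ⨟ liftR (liftR G₂) ⨟
      moveIn (.inr k₁) e₁ .T ⨟ moveW .T .R id ⨟ popW .R ⨟
      loadW (fun ρ => { ρ with s := ρ.bit, a := false }) ⨟ count ⨟
      ite (fun v => v.1.a) (loadW fun ρ => { ρ with a := ρ.s }) guessA))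
    (T := fun n => (n * 10 + 10 + T₁ n) + (n * 10 + 40 + T₂ n * 20))
    (.add (.add (.add (.mul .id (.const _)) (.const _)) hT₁)
      (.add (.add (.mul .id (.const _)) (.const _)) (.mul hT₂ (.const _)))) fun x => ?_
  have hw : (N.acc ∅ x - (if half then 0 else 1) * N.rej ∅ x : ℤ) - f (x.map φ) =
      (1 * N.acc ∅ x + (if half then 0 else -1) * N.rej ∅ x) + -f (x.map φ) := by
    cases half <;> simp <;> ring
  rw [hw]
  apply Ev.mono
  · apply Ev.guess
    · apply Ev.seq
      apply Ev.moveW (by decide)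
      simp only [wstk_X, wstk_T, List.map_id, List.append_nil, update_wstk_T, update_wstk_X]
      apply Ev.seq
      apply Ev.moveOut
      simp only [wstk_T, update_wstk_T, List.map_reverse, List.reverse_reverse, List.append_nil]
      apply Ev.seq
      rw [← Memory.join_nil]
      erw [Memory.update_join_inl]
      apply Ev.liftR
      apply Ev.liftL
      refine Ev.imp (h₁ 1 (if half then 0 else -1) x) fun v S w h => ?_
      obtain ⟨rfl, -⟩ := h
      cases ha : acc v
      · refine Ev.ite_false (t := 2) ha ?_
        cases half <;> simp only [Bool.false_eq_true, if_false, if_true]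
        · refine Ev.mono (t := 1) (Ev.loadW ?_) (by omega)
          simp
        -- Weight `0` for a rejecting path: it is continued by one accepting and one rejecting path,
        -- which cancel.
        · refine Ev.guessA (w₁ := 1) (w₂ := -1) ?_ ?_ <;> simp
      · refine Ev.ite_true (t := 2) ha ?_
        refine Ev.mono (t := 1) (Ev.loadW ?_) (by omega)
        simp
    · apply Ev.seq
      apply Ev.moveW (by decide)
      simp only [wstk_X, wstk_T, List.append_nil, update_wstk_T, update_wstk_X]
      apply Ev.seq
      apply Ev.moveOut
      simp only [wstk_T, update_wstk_T, List.map_reverse, List.reverse_reverse, List.append_nil]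
      apply Ev.seq
      rw [← Memory.join_nil]
      erw [Memory.update_join_inr]
      apply Ev.liftR
      apply Ev.liftR
      refine Ev.imp (h₂ (-f (x.map φ)) (x.map φ)) fun v S w h => ?_
      obtain ⟨hS, hl, rfl⟩ := h
      apply Ev.mono (t' := 12 * T₂ x.length + 10)
      · apply Ev.seq
        apply Ev.moveIn
        simp only [Memory.join_inr, hS, List.map_map, Equiv.self_comp_symm, List.map_id, wstk_T,
          update_wstk_T, List.append_nil]
        apply Ev.seq
        apply Ev.moveW (by decide)
        simp only [wstk_T, wstk_R, List.map_id, update_wstk_R, update_wstk_T, List.append_nil,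
          List.reverse_reverse]
        apply Ev.seq
        apply Ev.popW
        simp only [wstk_R, update_wstk_R]
        apply Ev.seq
        apply Ev.loadW
        apply Ev.seq
        -- The value `-f` is `|f|` copies of a unit whose sign is opposite to that of `f`. The flag
        -- `s` stores whether `f` is negative, and flagged paths accept exactly in this case.
        have hd : -f (x.map φ) = if false = true then (if f (x.map φ) < 0 then (1 : ℤ) else -1) else
            (((f (x.map φ)).natAbs.bits.foldr Nat.bit 0 : ℕ) : ℤ) *
              (if f (x.map φ) < 0 then 1 else -1) := by
          rw [foldr_bits, if_neg (by simp)]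
          split_ifs <;> omega
        rw [hd]
        apply Ev.count
        · apply Ev.ite_true (t := 2) rfl
          apply Ev.mono (t := 1)
          · apply Ev.loadW
            simp [encodeInt, Reg.bit]
          · omega
        · apply Ev.ite_false rfl
          -- The unflagged paths of `count` must have value `0`, so each ends in a cancelling pair.
          rw [← add_neg_cancel (1 : ℤ)]
          apply Ev.guessA <;> simp
      · have hSl : (S k₁).length = (encodeInt (f (x.map φ))).length := by
          rw [hS, List.length_map]
        simp [encodeInt] at hl hSl ⊢
        omega
  · simp
    omega

/-! ## A choice between two gap functions -/

/-- Pads the pair of a bit and a string by ones on the left. -/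
def pad (m : ℕ) (b : Bool) (y : List Bool) : List Bool :=
  List.replicate (m - y.length) true ++ false :: b :: y

/-- The length is independent of `y`, so a target that depends on the input length only is the same
for all questions with bound `m`. -/
theorem length_pad {m : ℕ} {b : Bool} {y : List Bool} (h : y.length ≤ m) :
    (pad m b y).length = m + 2 := by
  simp [pad]
  omega

/-- Removes the padding. -/
def unpad (w : List Bool) : List Bool := (w.dropWhile id).tail

theorem unpad_pad (m : ℕ) (b : Bool) (y : List Bool) : unpad (pad m b y) = b :: y := by
  rw [pad, unpad, List.dropWhile_append_of_pos]
  · simp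
  · intro a ha
    simpa using (List.mem_replicate.1 ha).2

namespace Chart

variable {W : Memory} {Q : (work.prod W).σ → (work.prod W).Stk → ℤ → Prop} {t : ℕ}
  {ρ : Reg} {v : W.σ} {S : work.Stk} {S' : W.Stk} {w : ℤ}

/-- Replaces the content `x` of `X` by `unpad x`. -/
def unpadX : Chart (work.prod W) := loopW .X Reg.bit (loadW id)

theorem Ev.unpadX (x : List Bool) {t p r u c : List Bool}
    (h : ∀ b, Q ({ ρ with r := b }, v) (Memory.join (wstk (unpad x) t p r u c) S') w) :
    Chart.unpadX.Ev (ρ, v) (Memory.join (wstk x t p r u c) S') (x.length * 2 + 1) Q w := by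
  induction x generalizing ρ with
  | nil =>
    refine (Ev.loopW_exit rfl ?_).mono (by simp)
    simp only [wstk_X, List.tail_nil, update_wstk_X]
    exact h _
  | cons b x ih =>
    cases b
    · refine (Ev.loopW_exit rfl ?_).mono (by simp)
      simp only [wstk_X, List.tail_cons, update_wstk_X]
      exact h _
    · refine (Ev.loopW_step (t := 1) (t' := x.length * 2 + 1) rfl ?_).mono
        (by simp only [List.length_cons]; omega)
      simp only [wstk_X, List.tail_cons, update_wstk_X]
      refine Ev.loadW ?_
      exact ih h

end Chart

open Chart in
/-- The bit in front of the padded string chooses between two gap functions. -/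
theorem choose_mem_GapP {g₁ g₂ : List Bool → ℤ} (h₁ : g₁ ∈ GapP) (h₂ : g₂ ∈ GapP) :
    (fun w => if (unpad w).head?.getD false then g₁ (unpad w).tail else g₂ (unpad w).tail) ∈
      GapP := by
  obtain ⟨N₁, hN₁, e₁⟩ := h₁
  obtain ⟨N₂, hN₂, e₂⟩ := h₂
  obtain ⟨W₁, G₁, k₁, i₁, v₁, acc₁, T₁, ⟨p₁, hp₁⟩, h₁⟩ := exists_chart_of_polyNTM N₁ hN₁
  obtain ⟨W₂, G₂, k₂, i₂, v₂, acc₂, T₂, ⟨p₂, hp₂⟩, h₂⟩ := exists_chart_of_polyNTM N₂ hN₂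
  set A : Chart (work.prod (W₁.prod W₂)) := moveW .X .T id ⨟ moveOut .T (.inl k₁) i₁.symm ⨟
    liftR (liftL G₁) ⨟ load fun v => ({ v.1 with a := acc₁ v.2.1 }, v.2) with hA
  set B : Chart (work.prod (W₁.prod W₂)) := moveW .X .T id ⨟ moveOut .T (.inr k₂) i₂.symm ⨟
    liftR (liftR G₂) ⨟ load fun v => ({ v.1 with a := acc₂ v.2.2 }, v.2) with hB
  have runA : ∀ ρ y, A.Ev (ρ, (v₁, v₂)) (Memory.join (wstk y [] [] [] [] []) (fun _ => []))
      (y.length * 4 + 3 + p₁.eval y.length) (fun v _ w => w = if v.1.a then 1 else -1) (g₁ y) := by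
    intro ρ y
    apply Ev.mono
    · apply Ev.seq
      apply Ev.moveW (by decide)
      simp only [wstk_X, wstk_T, List.map_id, List.append_nil, update_wstk_T, update_wstk_X]
      apply Ev.seq
      apply Ev.moveOut
      simp only [wstk_T, update_wstk_T, List.map_reverse, List.reverse_reverse, List.append_nil]
      apply Ev.seq
      rw [← Memory.join_nil]
      erw [Memory.update_join_inl]
      apply Ev.liftR
      apply Ev.liftL
      have hw : g₁ y = 1 * N₁.acc ∅ y + -1 * N₁.rej ∅ y := by rw [e₁, PolyNTM.gap]; ring
      rw [hw]
      exact (h₁ 1 (-1) y).imp fun v S w h => Ev.load h.1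
    · have := hp₁ y.length
      simp
      omega
  have runB : ∀ ρ y, B.Ev (ρ, (v₁, v₂)) (Memory.join (wstk y [] [] [] [] []) (fun _ => []))
      (y.length * 4 + 3 + p₂.eval y.length) (fun v _ w => w = if v.1.a then 1 else -1) (g₂ y) := by
    intro ρ y
    apply Ev.mono
    · apply Ev.seq
      apply Ev.moveW (by decide)
      simp only [wstk_X, wstk_T, List.map_id, List.append_nil, update_wstk_T, update_wstk_X]
      apply Ev.seq
      apply Ev.moveOut
      simp only [wstk_T, update_wstk_T, List.map_reverse, List.reverse_reverse, List.append_nil]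
      apply Ev.seq
      rw [← Memory.join_nil]
      erw [Memory.update_join_inr]
      apply Ev.liftR
      apply Ev.liftR
      have hw : g₂ y = 1 * N₂.acc ∅ y + -1 * N₂.rej ∅ y := by rw [e₂, PolyNTM.gap]; ring
      rw [hw]
      exact (h₂ 1 (-1) y).imp fun v S w h => Ev.load h.1
    · have := hp₂ y.length
      simp
      omega
  refine mem_GapP_of_work (W := W₁.prod W₂) (v₀ := (v₁, v₂))
    (unpadX ⨟ popW .X ⨟ ite (fun v => v.1.bit) A B)
    (T := fun n => (n * 2 + 1) + (1 + (n * 4 + 3 + (p₁.eval n + p₂.eval n) + 1)))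
    (.add (.add (.mul .id (.const _)) (.const _)) (.add (.const _) (.add (.add (.add
      (.mul .id (.const _)) (.const _)) (.add (.eval _) (.eval _))) (.const _)))) fun x => ?_
  have hlen : (unpad x).tail.length ≤ x.length := by
    have := (List.dropWhile_suffix (l := x) id).length_le
    simp only [unpad, List.length_tail]
    omega
  -- The string after unpadding may be shorter than the input. Polynomials are used as time bounds
  -- here because they are monotone.
  have ht₁ := eval_mono_nat p₁ hlen
  have ht₂ := eval_mono_nat p₂ hlen
  refine Ev.seq (Ev.unpadX _ fun b => Ev.seq (Ev.popW ?_))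
  simp only [wstk_X, update_wstk_X]
  cases hb : (unpad x).head?.getD false
  · exact Ev.ite_false hb ((runB _ _).mono (by omega))
  · exact Ev.ite_true hb ((runA _ _).mono (by omega))

/-! ## Simulation of single steps -/

/-- The memory of the machine `M` together with its current label and a note on the last step:
`none` for a deterministic step, `some none` for a nondeterministic step, and `some (some b)` for a
query that was answered by `b`. -/
@[reducible] def memStep (M : OracleNTM) : Memory where
  K := M.K
  decK := M.decK
  finK := M.finK
  Γ := M.Γ
  finΓ := M.finΓ
  σ := Option M.Λ × M.σ × Option (Option Bool)
  finσ := by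
    have := M.finΛ
    have := M.finσ
    infer_instance

/-- The statement `s`, where a jump is replaced by storing the label. -/
def stepStmt {M : OracleNTM} {Λ' : Type} :
    TM2.Stmt M.Γ M.Λ M.σ → TM2.Stmt (memStep M).Γ Λ' (memStep M).σ
  | .push k g q => .push k (fun v => g v.2.1) (stepStmt q)
  | .peek k g q => .peek k (fun v s => (v.1, g v.2.1 s, v.2.2)) (stepStmt q)
  | .pop k g q => .pop k (fun v s => (v.1, g v.2.1 s, v.2.2)) (stepStmt q)
  | .load g q => .load (fun v => (v.1, g v.2.1, v.2.2)) (stepStmt q)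
  | .branch p q₁ q₂ => .branch (fun v => p v.2.1) (stepStmt q₁) (stepStmt q₂)
  | .goto l => .load (fun v => (some (l v.2.1), v.2.1, none)) .halt
  | .halt => .load (fun v => (none, v.2.1, none)) .halt

theorem stepAux_stepStmt {M : OracleNTM} {Λ' : Type} (s : TM2.Stmt M.Γ M.Λ M.σ) (l : Option M.Λ)
    (v : M.σ) (n : Option (Option Bool)) (S : ∀ k, List (M.Γ k)) :
    TM2.stepAux (stepStmt (Λ' := Λ') s) (l, v, n) S =
      ⟨none, ((TM2.stepAux s v S).l, (TM2.stepAux s v S).var, none), (TM2.stepAux s v S).stk⟩ := by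
  induction s generalizing v S with
  | push k g q ih => exact ih _ _
  | peek k g q ih => exact ih _ _
  | pop k g q ih => exact ih _ _
  | load g q ih => exact ih _ _
  | branch p q₁ q₂ h₁ h₂ =>
    cases h : p v <;> simp only [stepStmt, TM2.stepAux, h, cond_true, cond_false, h₁, h₂]
  | goto l => rfl
  | halt => rfl

namespace Chart

/-- Executes one step of the machine `M`; the answers to queries are guessed, and the query stack
is left as it is. -/
def step (M : OracleNTM) : Chart (memStep M) where
  Λ := Option (M.Λ ⊕ (M.Λ × Option (Option Bool)))
  finΛ := by
    have := M.finΛ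
    infer_instance
  main := none
  prog
    | none => .run (.branch (fun v => v.1.isSome) (.goto fun v => v.1.map .inl)
        (.load (fun v => (v.1, v.2.1, none)) .halt))
    | some (.inl l) => match M.prog l with
      | .run s => .run (stepStmt s)
      | .guess l₁ l₂ => .fork (some (.inr (l₁, some none))) (some (.inr (l₂, some none)))
      | .query yes no =>
        .fork (some (.inr (yes, some (some true)))) (some (.inr (no, some (some false))))
    | some (.inr (l, n)) => .run (.load (fun v => (some l, v.2.1, n)) .halt)

variable {M : OracleNTM} {Q : (memStep M).σ → (memStep M).Stk → ℤ → Prop} {l : M.Λ}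
  {v : M.σ} {n : Option (Option Bool)} {S : (memStep M).Stk} {w : ℤ}

/-- A halted machine idles, so a simulation can run for the same number of rounds on all paths. -/
theorem Ev.step_none (h : Q (none, v, none) S w) : (Chart.step M).Ev (none, v, n) S 3 Q w :=
  .run rfl (.exit h)

theorem Ev.step_run {s : TM2.Stmt M.Γ M.Λ M.σ} (hs : M.prog l = .run s)
    (h : Q ((TM2.stepAux s v S).l, (TM2.stepAux s v S).var, none) (TM2.stepAux s v S).stk w) :
    (Chart.step M).Ev (some l, v, n) S 3 Q w := by
  refine .run rfl ?_
  refine Eval.run (G := Chart.step M) (l := some (Sum.inl l)) (s := stepStmt s)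
    (by simp only [Chart.step, hs]) ?_
  rw [stepAux_stepStmt]
  exact .exit h

theorem Ev.step_guess {l₁ l₂ : M.Λ} (hl : M.prog l = .guess l₁ l₂) {w₁ w₂ : ℤ}
    (h₁ : Q (some l₁, v, some none) S w₁) (h₂ : Q (some l₂, v, some none) S w₂) :
    (Chart.step M).Ev (some l, v, n) S 3 Q (w₁ + w₂) := by
  refine .run rfl ?_
  exact Eval.fork (G := Chart.step M) (l := some (Sum.inl l)) (by simp only [Chart.step, hl]; rfl)
    (.run rfl (.exit h₁)) (.run rfl (.exit h₂))

/-- Both answers are followed and noted in the state. The question stays on the query stack so that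
`ask` can still read it and evaluate the guess. -/
theorem Ev.step_query {l₁ l₂ : M.Λ} (hl : M.prog l = .query l₁ l₂) {w₁ w₂ : ℤ}
    (h₁ : Q (some l₁, v, some (some true)) S w₁) (h₂ : Q (some l₂, v, some (some false)) S w₂) :
    (Chart.step M).Ev (some l, v, n) S 3 Q (w₁ + w₂) := by
  refine .run rfl ?_
  exact Eval.fork (G := Chart.step M) (l := some (Sum.inl l)) (by simp only [Chart.step, hl]; rfl)
    (.run rfl (.exit h₁)) (.run rfl (.exit h₂))

end Chart

/-! ### Path counts and gaps from a configuration -/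

namespace OracleNTM

variable {M : OracleNTM} {O : Set (List Bool)}

/-- Halting configurations have no successors, so no path is counted again when the time bound is
raised. -/
theorem HaltsWithin.mono {t t' : ℕ} {c : M.Cfg} (h : M.HaltsWithin O t c) (ht : t ≤ t') :
    M.HaltsWithin O t' c ∧ ∀ b, M.numPaths O b t' c = M.numPaths O b t c := by
  induction t generalizing t' c with
  | zero =>
    obtain ⟨l, v, S⟩ := c
    obtain rfl : l = none := h
    constructor
    · cases t' <;> simp [HaltsWithin, next]
    · intro b
      rw [Chart.numPaths_none, Chart.numPaths_none]
  | succ t ih =>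
    obtain ⟨t', rfl⟩ := Nat.exists_eq_add_of_le' (Nat.one_le_iff_ne_zero.2 (by omega : t' ≠ 0))
    refine ⟨fun c' hc => (ih (h c' hc) (by omega)).1, fun b => ?_⟩
    rw [numPaths, numPaths]
    congr 2
    exact List.map_congr_left fun c' hc => (ih (h c' hc) (by omega)).2 b

variable (M O) in
/-- The difference between the numbers of accepting and of rejecting paths of at most `t` steps. -/
noncomputable def gapFrom (t : ℕ) (c : M.Cfg) : ℤ :=
  M.numPaths O true t c - M.numPaths O false t c

theorem gapFrom_none (t : ℕ) (v : M.σ) (S : ∀ k, List (M.Γ k)) :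
    M.gapFrom O t ⟨none, v, S⟩ = if M.accepting v then 1 else -1 := by
  rw [gapFrom, Chart.numPaths_none, Chart.numPaths_none]
  cases M.accepting v <;> simp

theorem gapFrom_succ (t : ℕ) (l : M.Λ) (v : M.σ) (S : ∀ k, List (M.Γ k)) :
    M.gapFrom O (t + 1) ⟨some l, v, S⟩ =
      ((M.next O ⟨some l, v, S⟩).map (M.gapFrom O t)).sum := by
  have : ∀ L : List M.Cfg, (L.map (M.gapFrom O t)).sum =
      ((L.map (M.numPaths O true t)).sum : ℕ) - ((L.map (M.numPaths O false t)).sum : ℕ) := by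
    intro L
    induction L with
    | nil => simp
    | cons c L ih =>
      simp only [List.map_cons, List.sum_cons, ih, gapFrom]
      push_cast
      ring
  rw [this, gapFrom, numPaths, numPaths]
  simp

end OracleNTM

theorem PolyNTM.gap_eq_gapFrom (N : PolyNTM) (O : Set (List Bool)) (x : List Bool) {t : ℕ}
    (ht : N.time.eval x.length ≤ t) : N.gap O x = N.gapFrom O t (N.initCfg x) := by
  have h := ((N.halts O x).mono ht).2
  rw [PolyNTM.gap, OracleNTM.gapFrom, h, h, PolyNTM.acc, PolyNTM.rej]

/-! ## Gap functions as counting functions -/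

namespace Chart

/-- Simulates the machine `M` and adds paths such that all paths branch in the same number of
steps, which is given by the content of `P`. The flag `a` marks the additional paths. -/
def fill (M : OracleNTM) : Chart (work.prod (memStep M)) :=
  eachW .P (ite (fun v => v.1.a) (guess (loadW id) (loadW id)) (liftR (step M) ⨟
    ite (fun v => v.2.2.2.isSome) (loadW id)
      (guess (loadW id) (loadW fun ρ => { ρ with a := true }))))

/-- The values at the exits of `fill`. -/
def FillExit (M : OracleNTM) (v : (work.prod (memStep M)).σ)
    (_ : (work.prod (memStep M)).Stk) (w : ℤ) : Prop :=
  w = if v.1.a then 1 else if M.accepting v.2.2.1 then 2 else 0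

variable {M : OracleNTM}

/-- An additional path doubles in each remaining round, and each of its ends is worth `1`. -/
theorem Ev.fill_true (t : ℕ) (r : Option Bool) (s : Bool) (v : (memStep M).σ)
    (x t' r' u c : List Bool) (S' : (memStep M).Stk) :
    (Chart.fill M).Ev (⟨r, true, s⟩, v) (Memory.join (wstk x t' (zeros t) r' u c) S') (t * 8 + 1)
      (FillExit M) (2 ^ t) := by
  induction t generalizing r with
  | zero =>
    refine Ev.mono (t := 1) ?_ (by simp)
    unfold Chart.fill Chart.eachW
    apply Ev.loopW_exit
    · rfl
    · rfl
  | succ t ih =>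
    refine Ev.mono (t := 7 + (t * 8 + 1) + 1) ?_ (by omega)
    unfold Chart.fill Chart.eachW
    apply Ev.loopW_step
    · rfl
    · simp only [wstk_P, zeros_succ, List.head?_cons, List.tail_cons, update_wstk_P]
      apply Ev.ite_true rfl
      refine Ev.mono (t := 2) ?_ (by omega)
      rw [pow_succ, mul_two]
      apply Ev.guess (t := 1) (t' := 1) <;>
      · apply Ev.loadW
        exact ih _

/-- The computation is completed to a full binary tree of depth `t` by splitting off an additional
path at every step that does not branch. Genuine ends are worth `2` or `0`, that is, `1` plus their
contribution `±1` to the gap; additional ends are worth `1`. The ones sum to the number `2 ^ t` of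
leaves, the rest to the gap. -/
theorem Ev.fill_false (hM : M.QueryFree) (O : Set (List Bool)) (t : ℕ) (r : Option Bool) (s : Bool)
    (m : Option (Option Bool)) (l : Option M.Λ) (v : M.σ)
    (x t' r' u c : List Bool) (S' : (memStep M).Stk) (h : M.HaltsWithin O t ⟨l, v, S'⟩) :
    (Chart.fill M).Ev (⟨r, false, s⟩, (l, v, m)) (Memory.join (wstk x t' (zeros t) r' u c) S')
      (t * 8 + 1) (FillExit M) (2 ^ t + M.gapFrom O t ⟨l, v, S'⟩) := by
  induction t generalizing r m l v S' with
  | zero =>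
    obtain rfl : l = none := h
    refine Ev.mono (t := 1) ?_ (by simp)
    unfold Chart.fill Chart.eachW
    apply Ev.loopW_exit
    · rfl
    · rw [OracleNTM.gapFrom_none, FillExit]
      cases M.accepting v <;> simp
  | succ t ih =>
    refine Ev.mono (t := 7 + (t * 8 + 1) + 1) ?_ (by omega)
    unfold Chart.fill Chart.eachW
    apply Ev.loopW_step
    · rfl
    simp only [wstk_P, zeros_succ, List.head?_cons, List.tail_cons, update_wstk_P]
    apply Ev.ite_false rfl
    apply Ev.seq (t := 3) (t' := 3)
    apply Ev.liftR
    have det : ∀ (l : Option M.Λ) (v : M.σ) (S' : (memStep M).Stk), M.HaltsWithin O t ⟨l, v, S'⟩ →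
        (Chart.ite (W := work.prod (memStep M)) (fun v => v.2.2.2.isSome) (Chart.loadW id)
          (Chart.guess (Chart.loadW id) (Chart.loadW fun ρ => { ρ with a := true }))).Ev
          (⟨some false, false, s⟩, (l, v, none)) (Memory.join (wstk x t' (zeros t) r' u c) S') 3
          (fun v S w => (Chart.fill M).Ev v S (t * 8 + 1) (FillExit M) w)
          (2 ^ (t + 1) + M.gapFrom O t ⟨l, v, S'⟩) := by
      intro l v S' h
      apply Ev.ite_false rfl
      rw [pow_succ, mul_two, add_right_comm]
      apply Ev.guess (t := 1) (t' := 1)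
      · apply Ev.loadW
        exact ih _ _ _ _ _ h
      · apply Ev.loadW
        exact Ev.fill_true ..
    have non : ∀ (l : Option M.Λ) (v : M.σ) (S' : (memStep M).Stk), M.HaltsWithin O t ⟨l, v, S'⟩ →
        (Chart.ite (W := work.prod (memStep M)) (fun v => v.2.2.2.isSome) (Chart.loadW id)
          (Chart.guess (Chart.loadW id) (Chart.loadW fun ρ => { ρ with a := true }))).Ev
          (⟨some false, false, s⟩, (l, v, some none))
          (Memory.join (wstk x t' (zeros t) r' u c) S') 3
          (fun v S w => (Chart.fill M).Ev v S (t * 8 + 1) (FillExit M) w)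
          (2 ^ t + M.gapFrom O t ⟨l, v, S'⟩) := by
      intro l v S' h
      apply Ev.ite_true (t := 2) rfl
      refine Ev.mono (t := 1) ?_ (by omega)
      apply Ev.loadW
      exact ih _ _ _ _ _ h
    rcases l with _ | l
    · apply Ev.step_none
      have hn : ∀ t, M.HaltsWithin O t ⟨none, v, S'⟩ := fun t => by
        cases t <;> simp [OracleNTM.HaltsWithin, OracleNTM.next]
      have := det none v S' (hn t)
      rw [OracleNTM.gapFrom_none] at this ⊢
      exact this
    · rw [OracleNTM.gapFrom_succ]
      rw [OracleNTM.HaltsWithin] at h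
      cases hl : M.prog l with
      | run s' =>
        simp only [OracleNTM.next, hl, List.mem_singleton, forall_eq, List.map_cons, List.map_nil,
          List.sum_cons, List.sum_nil, add_zero] at h ⊢
        apply Ev.step_run hl
        exact det _ _ _ h
      | guess l₁ l₂ =>
        simp only [OracleNTM.next, hl, List.mem_cons, forall_eq_or_imp, List.map_cons,
          List.map_nil, List.sum_cons, List.sum_nil, add_zero, List.not_mem_nil,
          IsEmpty.forall_iff, implies_true, and_true] at h ⊢
        rw [pow_succ, mul_two, add_add_add_comm]
        apply Ev.step_guess hl
        · exact non _ _ _ h.1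
        · exact non _ _ _ h.2
      | query l₁ l₂ => exact absurd hl (hM l l₁ l₂)

end Chart

open Chart in
/-- A gap function plus a suitable power of two is a counting function. -/
theorem exists_acc_eq_two_pow_add_gap {N : PolyNTM} (hN : N.QueryFree) :
    ∃ (N' : PolyNTM) (c k : ℕ), N'.QueryFree ∧
      ∀ x, (N'.acc ∅ x : ℤ) = 2 ^ (x.length + c) ^ k + N.gap ∅ x := by
  obtain ⟨k, -, hk⟩ := (PolyBdd.eval N.time).exists_le_add_pow
  obtain ⟨T, hT, hclock⟩ := exists_ev_clock k k
  have hm : PolyBdd fun n => (n + k) ^ k := (PolyBdd.add .id (.const _)).pow k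
  obtain ⟨N', hN', h⟩ := exists_polyNTM_of_work (W := memStep N.toOracleNTM)
    (clock k k ⨟ moveW .X .T id ⨟ moveOut .T N.inp N.inpAlphabet.symm ⨟ fill N.toOracleNTM ⨟
      ite (fun v => v.1.a) (loadW id) (ite (fun v => N.accepting v.2.2.1)
        (guess (loadW fun ρ => { ρ with a := true }) (loadW fun ρ => { ρ with a := true }))
        (loadW id)))
    (some N.main, N.initialState, none) (fun b => if b then 1 else 0)
    (g := fun x => 2 ^ (x.length + k) ^ k + N.gap ∅ x)
    (T := fun n => T n + ((n * 2 + 1) + ((n * 2 + 1) + (((n + k) ^ k * 8 + 1) + 4))))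
    (.add hT (.add (.add (.mul .id (.const _)) (.const _)) (.add (.add (.mul .id (.const _))
      (.const _)) (.add (.add (.mul hm (.const _)) (.const _)) (.const _))))) fun x => by
    apply Ev.mono
    · apply Ev.seq
      apply hclock
      apply Ev.seq
      apply Ev.moveW (by decide)
      simp only [wstk_X, wstk_T, List.map_id, List.append_nil, update_wstk_T, update_wstk_X]
      apply Ev.seq
      apply Ev.moveOut
      simp only [wstk_T, update_wstk_T, List.map_reverse, List.reverse_reverse, List.append_nil]
      apply Ev.seq
      rw [N.gap_eq_gapFrom ∅ x (hk x.length)]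
      have h := ((N.halts ∅ x).mono (hk x.length)).1
      apply Ev.imp
      · exact Ev.fill_false hN ∅ ((x.length + k) ^ k) none false none (some N.main) N.initialState
          _ _ _ _ _ _ h
      · rintro ⟨⟨r, a, s⟩, l, v, n⟩ S w rfl
        cases a
        · apply Ev.ite_false (t := 3) rfl
          cases hv : N.accepting v
          · apply Ev.ite_false (t := 2) hv
            refine Ev.mono (t := 1) ?_ (by omega)
            apply Ev.load
            simp
          · apply Ev.ite_true (t := 2) hv
            simp only [Bool.false_eq_true, if_false, if_true]
            -- The weight `2` of an accepting end is realized by two accepting paths.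
            rw [← one_add_one_eq_two (R := ℤ)]
            apply Ev.guess (t := 1) (t' := 1) <;>
            · apply Ev.load
              rfl
        · refine Ev.ite_true (t := 3) (by rfl) ?_
          refine Ev.mono (t := 1) ?_ (by omega)
          apply Ev.load
          rfl
    · simp
  refine ⟨N', k, k, hN', fun x => ?_⟩
  have := h x
  simpa using this.symm

/-- The support of a gap function is in `coC₌P`. -/
theorem support_mem_coCeqP {g : List Bool → ℤ} (hg : g ∈ GapP) : {x | g x ≠ 0} ∈ coCeqP := by
  obtain ⟨N, hN, h⟩ := hg
  obtain ⟨N', c, k, hN', h'⟩ := exists_acc_eq_two_pow_add_gap hN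
  refine ⟨N', hN', _, two_pow_mem_FP c k, fun x => ?_⟩
  rw [h', ← h]
  simp

/-! ## Simulation of oracle queries by a gap function -/

namespace Chart

variable {W₁ W₂ : Memory} {Q : (work.prod (W₁.prod W₂)).σ → (work.prod (W₁.prod W₂)).Stk → ℤ → Prop}

theorem Ev.pushR_single {k : W₂.K} {f : Reg → W₂.Γ k} {ρ : Reg} {v : W₁.σ × W₂.σ} {S : work.Stk}
    {S₁ : W₁.Stk} {l : List (W₂.Γ k)} {w : ℤ}
    (h : Q (ρ, v) (Memory.join S (Memory.join S₁ (Memory.single k (f ρ :: l)))) w) :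
    (Chart.pushR (W := W₁.prod W₂) (.inr k) f).Ev (ρ, v)
      (Memory.join S (Memory.join S₁ (Memory.single k l))) 1 Q w := by
  apply Ev.pushR
  rw [Memory.update_join_inr]
  simpa [Memory.single] using h

/-- Writes the padded pair of the flag `a` and the reverse of `T` onto the stack `k` of the last
memory, executes the chart `G` there, changes the flag `s` if the result is rejecting, and restores
the last memory. The content of `P` gives the length of the padding. -/
def ask (G : Chart W₂) (k : W₂.K) (e : W₂.Γ k ≃ Bool) (v₀ : W₂.σ) (acc : W₂.σ → Bool)
    (ks : List W₂.K) : Chart (work.prod (W₁.prod W₂)) :=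
  eachW .T (pushR (.inr k) (fun ρ => e.symm ρ.bit) ⨟ popW .P ⨟ pushW .R fun _ => false) ⨟
  pushR (.inr k) (fun ρ => e.symm ρ.a) ⨟ pushR (.inr k) (fun _ => e.symm false) ⨟
  eachW .P (pushW .R (fun _ => false) ⨟ pushR (.inr k) fun _ => e.symm true) ⨟
  moveW .R .P id ⨟ liftR (liftR G) ⨟
  load (fun v => ({ v.1 with s := v.1.s ^^ !acc v.2.2 }, v.2.1, v₀)) ⨟ clear (ks.map .inr)

/-- A bound for the time of `ask`. -/
def askTime (ks : ℕ) (T : ℕ → ℕ) (m : ℕ) : ℕ :=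
  m * 12 + 10 + T (m + 2) + (ks * (T (m + 2) * 2 + 1))

/-- Running `G` multiplies the value of the continuation by the gap `g (pad m a y)`: the sign of
each path of `G` is recorded in `s`, and the continuation has value `w` or `-w` accordingly. The
zeros on `P` and the memory of `G` are restored, so that calls can be repeated. -/
theorem Ev.ask {G : Chart W₂} {k : W₂.K} {e : W₂.Γ k ≃ Bool} {v₀ : W₂.σ} {acc : W₂.σ → Bool}
    {ks : List W₂.K} (hks : ∀ k, k ∈ ks) {T : ℕ → ℕ} {g : List Bool → ℤ}
    (hG : ∀ (d : ℤ) (x : List Bool), G.Ev v₀ (Memory.single k (x.map e.symm)) (T x.length)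
      (fun v S w => w = (if acc v then d else -d) ∧ ∀ k, (S k).length ≤ T x.length) (d * g x))
    {m : ℕ} {y : List Bool} (hy : y.length ≤ m) {r : Option Bool} {a s : Bool} {v : W₁.σ}
    {S : W₁.Stk} {x u c : List Bool} {w : ℤ}
    (h : ∀ s, Q (⟨none, a, s⟩, v, v₀) (Memory.join (wstk x [] (zeros m) [] u c)
      (Memory.join S fun _ => [])) (if s then -w else w)) :
    (Chart.ask G k e v₀ acc ks).Ev (⟨r, a, s⟩, v, v₀) (Memory.join
      (wstk x y.reverse (zeros m) [] u c) (Memory.join S fun _ => [])) (askTime ks.length T m) Q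
      ((if s then -w else w) * g (pad m a y)) := by
  apply Ev.mono
  · apply Ev.seq
    -- While `y` is written, one zero goes from `P` to `R` for every symbol, so that the zeros left
    -- on `P` measure the padding.
    refine Ev.eachW (t := 1 + (1 + 1)) (fun l ρ v' S₁ S₁' => v' = (v, v₀) ∧
      { ρ with r := none } = ⟨none, a, s⟩ ∧ ∃ l', y.reverse = l' ++ l ∧
        S₁ = wstk x l (zeros (m - l'.length)) (zeros l'.length) u c ∧
        S₁' = Memory.join S (Memory.single k (l'.reverse.map e.symm))) ?_ ?_ y.reverse ?_ ?_
    · rintro l ρ v S S' ⟨-, -, l', -, rfl, -⟩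
      rfl
    · rintro b l ρ v' S₁ S₁' ⟨rfl, hρ, l', hl, rfl, rfl⟩ Q hQ
      apply Ev.seq
      apply Ev.pushR_single
      apply Ev.seq
      apply Ev.popW
      apply Ev.pushW
      simp only [update_wstk_T, wstk_P, wstk_R, update_wstk_P, update_wstk_R]
      refine hQ _ _ _ _ ⟨rfl, hρ, l' ++ [b], by simp [hl], ?_, ?_⟩
      · rw [List.length_append, List.length_singleton, zeros_succ, ← Nat.sub_sub]
        simp [zeros]
      · simp [Reg.bit]
    · refine ⟨rfl, rfl, [], rfl, rfl, ?_⟩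
      simp [Memory.single]
    rintro ρ v' S₁ S₁' ⟨rfl, hρ, l', hl, rfl, rfl⟩
    rw [List.append_nil] at hl
    obtain rfl : y = l'.reverse := by rw [← hl, List.reverse_reverse]
    rw [hρ]
    rw [List.length_reverse] at hy
    simp only [update_wstk_T]
    apply Ev.seq
    apply Ev.pushR_single
    apply Ev.seq
    apply Ev.pushR_single
    apply Ev.seq
    -- The remaining `m - |y|` zeros each produce a padding symbol. They also go to `R`, which
    -- finally holds all `m` zeros.
    refine Ev.mono (t' := m * 3 + 1) (Ev.eachW (t := 1 + 1) (fun l ρ v' S₁ S₁' => v' = (v, v₀) ∧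
      { ρ with r := none } = ⟨none, a, s⟩ ∧ ∃ i, i + l.length = m - l'.length ∧
        S₁ = wstk x [] l (zeros (i + l'.length)) u c ∧
        S₁' = Memory.join S (Memory.single k
          ((List.replicate i true ++ false :: a :: l'.reverse).map e.symm))) ?_ ?_
        (zeros (m - l'.length)) ?_ ?_) (by simp)
    · rintro l ρ v S S' ⟨-, -, i, -, rfl, -⟩
      rfl
    · rintro b l ρ v' S₁ S₁' ⟨rfl, hρ, i, hl, rfl, rfl⟩ Q hQ
      apply Ev.seq
      apply Ev.pushW
      apply Ev.pushR_single
      simp only [update_wstk_P, wstk_R, update_wstk_R]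
      refine hQ _ _ _ _ ⟨rfl, hρ, i + 1, by rw [← hl, List.length_cons]; omega, ?_, ?_⟩
      · rw [Nat.add_right_comm, zeros_succ]
      · simp [List.replicate_succ]
    · exact ⟨rfl, rfl, 0, by simp, by simp, by simp⟩
    rintro ρ v' S₁ S₁' ⟨rfl, hρ, i, hi, rfl, rfl⟩
    rw [hρ]
    obtain rfl : i = m - l'.length := by simpa using hi
    have hpad : List.replicate (m - l'.length) true ++ false :: a :: l'.reverse =
        pad m a l'.reverse := by simp [pad]
    rw [hpad, Nat.sub_add_cancel hy]
    have hlen : (pad m a l'.reverse).length = m + 2 := length_pad (by simpa using hy)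
    simp only [update_wstk_P]
    apply Ev.seq
    refine Ev.mono (t' := m * 2 + 1) (Ev.moveW (by decide) ?_) (by simp)
    simp only [wstk_R, wstk_P, update_wstk_P, update_wstk_R, List.map_id, reverse_zeros,
      List.append_nil]
    apply Ev.seq
    -- The free weight of `hG` is the signed value of the continuation; a rejecting end of `G`
    -- negates it, which is what flipping `s` achieves.
    refine Ev.mono (t' := T (m + 2)) (Ev.liftR (Ev.liftR (Ev.imp
      (hG (if s then -w else w) (pad m a l'.reverse)) fun v' S' w' h' => ?_))) (by rw [hlen])
    obtain ⟨rfl, hS'⟩ := h'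
    apply Ev.seq
    apply Ev.load
    refine Ev.clear (T (m + 2)) _ ?_ ?_
    · intro j hj
      obtain ⟨j, -, rfl⟩ := List.mem_map.1 hj
      rw [← hlen]
      exact hS' j
    · have hw : (if acc v' then (if s then -w else w) else -(if s then -w else w)) =
          if (s ^^ !acc v') then -w else w := by
        cases s <;> cases acc v' <;> simp
      rw [hw]
      convert h (s ^^ !acc v') using 2
      funext j
      rcases j with j | j
      · simp
      · simp [hks]
  · simp [askTime]
    omega

/-- Simulates as many steps of the oracle machine `M` as `C` says, where the answers to queries are
guessed and every step is followed by a call of `ask` for the guessed answer, or by a call for the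
empty string and its answer `b₀`. -/
def simulate (M : OracleNTM) (b₀ : Bool) (G : Chart W₂) (k : W₂.K) (e : W₂.Γ k ≃ Bool) (v₀ : W₂.σ)
    (acc : W₂.σ → Bool) (ks : List W₂.K) : Chart (work.prod ((memStep M).prod W₂)) :=
  eachW .C (liftR (liftL (step M)) ⨟
    ite (fun v => (v.2.1.2.2.getD none).isSome)
      (load (fun v => ({ v.1 with a := (v.2.1.2.2.getD none).getD false }, v.2)) ⨟
        moveIn (.inl M.qry) M.qryAlphabet .T)
      (loadW fun ρ => { ρ with a := b₀ }) ⨟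
    ask G k e v₀ acc ks)

/-- A bound for the time of one round of `simulate`. -/
def roundTime (ks : ℕ) (T : ℕ → ℕ) (m : ℕ) : ℕ := 3 + ((1 + (m * 2 + 1) + 1) + askTime ks T m)

/-- The values at the exits of `simulate`. -/
def SimulateExit (M : OracleNTM) (v : (work.prod ((memStep M).prod W₂)).σ)
    (_ : (work.prod ((memStep M).prod W₂)).Stk) (w : ℤ) : Prop :=
  w = if v.1.s ^^ M.accepting v.2.1.2.1 then 1 else -1

/-- The value of the simulation is the gap of the oracle machine, multiplied by a factor `γ` for
every step, because wrong answers have the value zero. -/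
theorem exists_ev_simulate {M : OracleNTM} {B : Set (List Bool)} {D : ℕ}
    (hD : ∀ l s, M.prog l = .run s → pushes s ≤ D) {b₀ : Bool} (hb₀ : [] ∈ B ↔ b₀ = true)
    {G : Chart W₂} {k : W₂.K} {e : W₂.Γ k ≃ Bool} {v₀ : W₂.σ} {acc : W₂.σ → Bool}
    {ks : List W₂.K} (hks : ∀ k, k ∈ ks) {T : ℕ → ℕ} {g : List Bool → ℤ}
    (hG : ∀ (d : ℤ) (x : List Bool), G.Ev v₀ (Memory.single k (x.map e.symm)) (T x.length)
      (fun v S w => w = (if acc v then d else -d) ∧ ∀ (k : W₂.K), (S k).length ≤ T x.length) (d * g x))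
    {m : ℕ} {γ : ℤ}
    (hγ : ∀ b (y : List Bool), y.length ≤ m → (y ∈ B ↔ b = true) → g (pad m b y) = γ)
    (h₀ : ∀ b (y : List Bool), y.length ≤ m → ¬ (y ∈ B ↔ b = true) → g (pad m b y) = 0)
    (x u : List Bool) (t : ℕ) (l : Option M.Λ) (v : M.σ) (n : Option (Option Bool))
    (S : (memStep M).Stk) (hS : ∀ k, (S k).length + D * t ≤ m) :
    ∃ V : ℤ, (M.HaltsWithin B t ⟨l, v, S⟩ → V = γ ^ t * M.gapFrom B t ⟨l, v, S⟩) ∧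
      ∀ r a s, (simulate M b₀ G k e v₀ acc ks).Ev (⟨r, a, s⟩, (l, v, n), v₀)
        (Memory.join (wstk x [] (zeros m) [] u (zeros t)) (Memory.join S fun _ => []))
        (t * (roundTime ks.length T m + 1) + 1) (SimulateExit M) (if s then -V else V) := by
  induction t generalizing l v n S with
  | zero =>
    -- A configuration that has not halted also needs a value, because wrong guesses may lead to
    -- computations longer than `t`. No equation is claimed for it; a later factor `0` removes it.
    refine ⟨if M.accepting v then 1 else -1, fun h => ?_, fun r a s => ?_⟩
    · obtain rfl : l = none := h
      rw [OracleNTM.gapFrom_none, pow_zero, one_mul]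
    · refine Ev.mono (t := 1) ?_ (by simp)
      unfold Chart.simulate Chart.eachW
      apply Ev.loopW_exit
      · rfl
      · rw [SimulateExit]
        cases s <;> cases M.accepting v <;> simp
  | succ t ih =>
    have hS' : ∀ k, (S k).length + D * t + D ≤ m := fun k => by
      have := hS k
      rw [mul_add, mul_one] at this
      omega
    have start : ∀ {V : ℤ},
        (∀ r s, (liftR (liftL (Chart.step M)) ⨟
          Chart.ite (W := work.prod ((memStep M).prod W₂))
            (fun v => (v.2.1.2.2.getD none).isSome)
            (Chart.load (fun v => ({ v.1 with a := (v.2.1.2.2.getD none).getD false }, v.2)) ⨟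
              Chart.moveIn (.inl M.qry) M.qryAlphabet .T)
            (Chart.loadW fun ρ => { ρ with a := b₀ }) ⨟
          Chart.ask G k e v₀ acc ks).Ev (⟨some false, r, s⟩, (l, v, n), v₀)
          (Memory.join (wstk x [] (zeros m) [] u (zeros t)) (Memory.join S fun _ => []))
          (roundTime ks.length T m) (fun v S w => (simulate M b₀ G k e v₀ acc ks).Ev v S
            (t * (roundTime ks.length T m + 1) + 1) (SimulateExit M) w) (if s then -V else V)) →
        ∀ r a s, (simulate M b₀ G k e v₀ acc ks).Ev (⟨r, a, s⟩, (l, v, n), v₀)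
        (Memory.join (wstk x [] (zeros m) [] u (zeros (t + 1))) (Memory.join S fun _ => []))
        ((t + 1) * (roundTime ks.length T m + 1) + 1) (SimulateExit M) (if s then -V else V) := by
      intro V h r a s
      refine Ev.mono (t := roundTime ks.length T m + (t * (roundTime ks.length T m + 1) + 1) + 1) ?_
        (by rw [add_mul, one_mul]; omega)
      unfold Chart.simulate Chart.eachW
      apply Ev.loopW_step
      · rfl
      simp only [wstk_C, zeros_succ, List.head?_cons, List.tail_cons, update_wstk_C]
      exact h a s
    -- A step without query makes the dummy call for the empty string with its correct answer `b₀`,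
    -- which contributes the same factor `γ` as a correctly answered query.
    have det : ∀ {l : Option M.Λ} {v : M.σ} {n : Option (Option Bool)} {S : (memStep M).Stk} {V : ℤ},
        (n.getD none).isSome = false →
        (∀ r a s, (simulate M b₀ G k e v₀ acc ks).Ev (⟨r, a, s⟩, (l, v, n), v₀)
          (Memory.join (wstk x [] (zeros m) [] u (zeros t)) (Memory.join S fun _ => []))
          (t * (roundTime ks.length T m + 1) + 1) (SimulateExit M) (if s then -V else V)) →
        ∀ r a s, (Chart.ite (W := work.prod ((memStep M).prod W₂))
            (fun v => (v.2.1.2.2.getD none).isSome)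
            (Chart.load (fun v => ({ v.1 with a := (v.2.1.2.2.getD none).getD false }, v.2)) ⨟
              Chart.moveIn (.inl M.qry) M.qryAlphabet .T)
            (Chart.loadW fun ρ => { ρ with a := b₀ }) ⨟
          Chart.ask G k e v₀ acc ks).Ev (⟨r, a, s⟩, (l, v, n), v₀)
          (Memory.join (wstk x [] (zeros m) [] u (zeros t)) (Memory.join S fun _ => []))
          ((1 + (m * 2 + 1) + 1) + askTime ks.length T m)
          (fun v S w => (simulate M b₀ G k e v₀ acc ks).Ev v S
            (t * (roundTime ks.length T m + 1) + 1) (SimulateExit M) w)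
          ((if s then -V else V) * γ) := by
      intro l v n S V hn hV r a s
      apply Ev.seq
      refine Ev.ite_false hn ?_
      refine Ev.mono (t := 1) ?_ (by omega)
      apply Ev.loadW
      rw [← hγ b₀ [] (Nat.zero_le _) hb₀]
      exact Ev.ask (W₁ := memStep M) (y := []) hks hG (Nat.zero_le _) fun s => hV _ _ s
    -- After a query, the guessed answer `b` is tested against the content of the query stack;
    -- `moveIn` reads this and empties the stack, as the oracle query would.
    have qry : ∀ {l : Option M.Λ} {v : M.σ} {b : Bool} {V : ℤ},
        (∀ r a s, (simulate M b₀ G k e v₀ acc ks).Ev (⟨r, a, s⟩, (l, v, some (some b)), v₀)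
          (Memory.join (wstk x [] (zeros m) [] u (zeros t))
            (Memory.join (Function.update S M.qry []) fun _ => []))
          (t * (roundTime ks.length T m + 1) + 1) (SimulateExit M) (if s then -V else V)) →
        ∀ r a s, (Chart.ite (W := work.prod ((memStep M).prod W₂))
            (fun v => (v.2.1.2.2.getD none).isSome)
            (Chart.load (fun v => ({ v.1 with a := (v.2.1.2.2.getD none).getD false }, v.2)) ⨟
              Chart.moveIn (.inl M.qry) M.qryAlphabet .T)
            (Chart.loadW fun ρ => { ρ with a := b₀ }) ⨟
          Chart.ask G k e v₀ acc ks).Ev (⟨r, a, s⟩, (l, v, some (some b)), v₀)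
          (Memory.join (wstk x [] (zeros m) [] u (zeros t)) (Memory.join S fun _ => []))
          ((1 + (m * 2 + 1) + 1) + askTime ks.length T m)
          (fun v S w => (simulate M b₀ G k e v₀ acc ks).Ev v S
            (t * (roundTime ks.length T m + 1) + 1) (SimulateExit M) w)
          ((if s then -V else V) * g (pad m b ((S M.qry).map M.qryAlphabet))) := by
      intro l v b V hV r a s
      have hy : ((S M.qry).map M.qryAlphabet).length ≤ m := by
        have := hS M.qry
        rw [List.length_map]
        omega
      apply Ev.seq
      refine Ev.ite_true rfl ?_
      apply Ev.seq
      apply Ev.load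
      refine Ev.mono (t' := m * 2 + 1) (Ev.moveIn ?_) ?_
      · simp only [wstk_T, update_wstk_T, List.append_nil]
        rw [Memory.update_join_inl]
        exact Ev.ask (W₁ := memStep M) hks hG hy fun s => hV _ _ s
      · have := hS M.qry
        change (S M.qry).length * 2 + 1 ≤ _
        omega
    have sum : ∀ (s : Bool) (a b c d : ℤ), (if s then -(a * c + b * d) else a * c + b * d) =
        (if s then -a else a) * c + (if s then -b else b) * d := by
      intro s a b c d
      cases s
      · simp
      · simp; ring
    have mul : ∀ (s : Bool) (a c : ℤ), (if s then -(a * c) else a * c) =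
        (if s then -a else a) * c := by
      intro s a c
      cases s <;> simp
    have hS₀ : ∀ k, (S k).length + D * t ≤ m := fun k => by
      have := hS' k
      omega
    rcases l with _ | l
    · obtain ⟨V, hV, h⟩ := ih none v none S hS₀
      refine ⟨V * γ, fun _ => ?_, start fun a s => ?_⟩
      · rw [hV (by cases t <;> simp [OracleNTM.HaltsWithin, OracleNTM.next]),
          OracleNTM.gapFrom_none, OracleNTM.gapFrom_none, pow_succ]
        ring
      · rw [mul]
        apply Ev.seq
        apply Ev.liftR
        apply Ev.liftL
        apply Ev.step_none
        exact det rfl h _ _ _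
    · rw [OracleNTM.gapFrom_succ, OracleNTM.HaltsWithin]
      cases hl : M.prog l with
      | run s' =>
        obtain ⟨V, hV, h⟩ := ih (TM2.stepAux s' v S).l (TM2.stepAux s' v S).var none
          (TM2.stepAux s' v S).stk fun k => by
            have h1 := length_stepAux_le s' v S (m - D * t - D) (fun k => by
              have := hS' k
              omega) k
            have h2 := hD l s' hl
            have h3 := hS' k
            omega
        refine ⟨V * γ, fun hh => ?_, start fun a s => ?_⟩
        · simp only [OracleNTM.next, hl, List.mem_singleton, forall_eq] at hh
          simp only [OracleNTM.next, hl, List.map_cons, List.map_nil, List.sum_cons, List.sum_nil,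
            add_zero]
          rw [hV hh, pow_succ]
          ring
        · rw [mul]
          apply Ev.seq
          apply Ev.liftR
          apply Ev.liftL
          apply Ev.step_run hl
          exact det rfl h _ _ _
      | guess l₁ l₂ =>
        obtain ⟨V₁, hV₁, h₁⟩ := ih (some l₁) v (some none) S hS₀
        obtain ⟨V₂, hV₂, h₂⟩ := ih (some l₂) v (some none) S hS₀
        refine ⟨V₁ * γ + V₂ * γ, fun hh => ?_, start fun a s => ?_⟩
        · simp only [OracleNTM.next, hl, List.mem_cons, forall_eq_or_imp, List.not_mem_nil,
            IsEmpty.forall_iff, implies_true, and_true] at hh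
          simp only [OracleNTM.next, hl, List.map_cons, List.map_nil, List.sum_cons, List.sum_nil,
            add_zero]
          rw [hV₁ hh.1, hV₂ hh.2, pow_succ]
          ring
        · rw [sum]
          apply Ev.seq
          apply Ev.liftR
          apply Ev.liftL
          apply Ev.step_guess hl
          · exact det rfl h₁ _ _ _
          · exact det rfl h₂ _ _ _
      | query l₁ l₂ =>
        have hS₁ : ∀ k, (Function.update S M.qry [] k).length + D * t ≤ m := fun k => by
          have := hS₀ k
          by_cases hk : k = M.qry
          · subst hk
            rw [Function.update_self, List.length_nil]
            omega
          · rwa [Function.update_of_ne hk]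
        have hy : ((S M.qry).map M.qryAlphabet).length ≤ m := by
          have := hS M.qry
          rw [List.length_map]
          omega
        obtain ⟨V₁, hV₁, h₁⟩ := ih (some l₁) v (some (some true)) _ hS₁
        obtain ⟨V₂, hV₂, h₂⟩ := ih (some l₂) v (some (some false)) _ hS₁
        refine ⟨V₁ * g (pad m true ((S M.qry).map M.qryAlphabet)) +
          V₂ * g (pad m false ((S M.qry).map M.qryAlphabet)), fun hh => ?_, start fun a s => ?_⟩
        · simp only [OracleNTM.next, hl, List.mem_singleton, forall_eq] at hh
          simp only [OracleNTM.next, hl, List.map_cons, List.map_nil, List.sum_cons, List.sum_nil,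
            add_zero]
          -- The successor with the right answer gets the factor `γ`, the other one the factor `0`.
          by_cases hB : (S M.qry).map M.qryAlphabet ∈ B
          · rw [if_pos hB] at hh ⊢
            rw [hγ true _ hy (by simp [hB]), h₀ false _ hy (by simp [hB]), hV₁ hh, pow_succ]
            ring
          · rw [if_neg hB] at hh ⊢
            rw [hγ false _ hy (by simp [hB]), h₀ true _ hy (by simp [hB]), hV₂ hh, pow_succ]
            ring
        · rw [sum]
          apply Ev.seq
          apply Ev.liftR
          apply Ev.liftL
          apply Ev.step_query hl
          · exact qry h₁ _ _ _
          · exact qry h₂ _ _ _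

end Chart

/-! ## Oracles that are decided by a gap function -/

theorem OracleNTM.exists_pushes_le (M : OracleNTM) :
    ∃ D, ∀ l s, M.prog l = .run s → pushes s ≤ D := by
  have := M.finΛ
  obtain ⟨D, hD⟩ := Set.Finite.bddAbove (Set.finite_range fun l =>
    match M.prog l with
    | .run s => pushes s
    | _ => 0)
  refine ⟨D, fun l s h => ?_⟩
  have := hD ⟨l, rfl⟩
  simpa [h] using this

open Chart in
/-- If a gap function has, on the padded pairs of a bit and a string, a value that depends on the
length only and is not zero for the right answers of the oracle `B`, and the value zero for the
wrong answers, then the oracle `B` does not help `PP`. -/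
theorem PPOracle_subset_PP {B : Set (List Bool)} {g : List Bool → ℤ} (hg : g ∈ GapP) {γ : ℕ → ℤ}
    (hne : ∀ m, γ m ≠ 0)
    (hγ : ∀ m b (y : List Bool), y.length ≤ m → (y ∈ B ↔ b = true) → g (pad m b y) = γ m)
    (h₀ : ∀ m b (y : List Bool), y.length ≤ m → ¬ (y ∈ B ↔ b = true) → g (pad m b y) = 0) :
    PPOracle B ⊆ PP := by
  rintro A ⟨N, hA⟩
  obtain ⟨N', hN', eg⟩ := hg
  obtain ⟨W, G, k, e, v₀, acc, T, hT, hG⟩ := exists_chart_of_polyNTM N' hN'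
  replace hG : ∀ (d : ℤ) (x : List Bool), G.Ev v₀ (Memory.single k (x.map e.symm)) (T x.length)
      (fun v S w => w = (if acc v then d else -d) ∧ ∀ k, (S k).length ≤ T x.length) (d * g x) := by
    intro d x
    have hw : d * g x = d * N'.acc ∅ x + -d * N'.rej ∅ x := by rw [eg, PolyNTM.gap]; ring
    rw [hw]
    exact hG d (-d) x
  obtain ⟨ks, hks⟩ : ∃ ks : List W.K, ∀ k, k ∈ ks :=
    ⟨(Set.finite_univ (α := W.K)).toFinset.toList, by simp⟩
  obtain ⟨b₀, hb₀⟩ : ∃ b₀, [] ∈ B ↔ b₀ = true := by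
    by_cases h : [] ∈ B
    · exact ⟨true, by simp [h]⟩
    · exact ⟨false, by simp [h]⟩
  obtain ⟨D, hD⟩ := N.exists_pushes_le
  obtain ⟨c, hc, htime⟩ := (PolyBdd.eval N.time).exists_le_add_pow
  -- With `p n = (n + K) ^ K`, the choice `K ≥ c` makes `p` a time bound. Moreover, `K ≥ 2 * D` and
  -- `p n ≥ 1` give `n + D * (2 * p n) ≤ p n * (n + K) = m n`, so no stack outgrows `m` in `2 * p n`
  -- steps and every question can be padded.
  obtain ⟨K, hK⟩ : ∃ K, K = c + 2 * D := ⟨_, rfl⟩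
  obtain ⟨T₁, hT₁, hclock⟩ := exists_ev_clock K K
  obtain ⟨p, hp⟩ : ∃ p : ℕ → ℕ, p = fun n => (n + K) ^ K := ⟨_, rfl⟩
  have hp₁ : PolyBdd p := hp ▸ (PolyBdd.add .id (.const _)).pow K
  have hpK : PolyBdd fun n => n + K := .add .id (.const _)
  obtain ⟨m, hm⟩ : ∃ m : ℕ → ℕ, m = fun n => p n * (n + K) := ⟨_, rfl⟩
  have hm₁ : PolyBdd m := hm ▸ hp₁.mul hpK
  have hpos : ∀ n, 1 ≤ p n := fun n => by
    rw [hp]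
    exact Nat.one_le_pow _ _ (by omega)
  have hround : PolyBdd (roundTime ks.length T) := by
    have hT₂ : PolyBdd fun n => T (n + 2) := hT.comp (.add .id (.const _))
    exact .add (.const _) (.add (.add (.add (.const _) (.add (.mul .id (.const _)) (.const _)))
      (.const _)) (.add (.add (.add (.mul .id (.const _)) (.const _)) hT₂)
        (.mul (.const _) (.add (.mul hT₂ (.const _)) (.const _)))))
  -- The simulation runs for `p + p` rounds instead of `p` so that the exponent is even and the
  -- power of `γ` is positive, whatever the sign of `γ`.
  have hGapP : (fun x => γ (m x.length) ^ (p x.length + p x.length) * N.gap B x) ∈ GapP := by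
    refine mem_GapP_of_work (W := (memStep N.toOracleNTM).prod W)
      (v₀ := ((some N.main, N.initialState, none), v₀))
      (clock K K ⨟ copyW .P .R .C ⨟ copyW .R .P .C ⨟ mulPU ⨟ moveW .X .T id ⨟
        moveOut .T (.inl N.inp) N.inpAlphabet.symm ⨟
        simulate N.toOracleNTM b₀ G k e v₀ acc ks ⨟
        load fun v => ({ v.1 with a := v.1.s ^^ N.accepting v.2.1.2.1 }, v.2))
      (T := fun n => T₁ n + ((p n * 3 + 1) + ((p n * 3 + 1) + (((p n * 2 + 1) +
        (p n * (((n + K) * 3 + 1) + ((n + K) * 2 + 1) + 1) + 1)) + ((n * 2 + 1) + ((n * 2 + 1) +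
        (((p n + p n) * (roundTime ks.length T (m n) + 1) + 1) + 1)))))))
      ?_ fun x => ?_
    · have h3 : PolyBdd fun n => p n * 3 + 1 := .add (.mul hp₁ (.const _)) (.const _)
      have h2 : PolyBdd fun n => n * 2 + 1 := .add (.mul .id (.const _)) (.const _)
      exact .add hT₁ (.add h3 (.add h3 (.add (.add (.add (.mul hp₁ (.const _)) (.const _))
        (.add (.mul hp₁ (.add (.add (.add (.mul hpK (.const _)) (.const _))
          (.add (.mul hpK (.const _)) (.const _))) (.const _))) (.const _))) (.add h2 (.add h2
          (.add (.add (.mul (.add hp₁ hp₁) (.add (hround.comp hm₁) (.const _))) (.const _))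
            (.const _)))))))
    have hle : N.time.eval x.length ≤ p x.length + p x.length := by
      refine (htime _).trans (le_add_right ?_)
      rw [hp]
      exact (Nat.pow_le_pow_left (by omega) c).trans (Nat.pow_le_pow_right (by omega) (by omega))
    have hS : ∀ j, ((N.initCfg x).stk j).length + D * (p x.length + p x.length) ≤ m x.length := by
      intro j
      have h1 : ((N.initCfg x).stk j).length ≤ x.length := by
        by_cases hj : j = N.inp
        · subst hj; simp [OracleNTM.initCfg]
        · simp [OracleNTM.initCfg, hj]
      have h2 : D * (p x.length + p x.length) ≤ p x.length * K := by
        rw [← mul_two, mul_left_comm, mul_comm D]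
        exact Nat.mul_le_mul_left _ (by omega)
      have h3 := Nat.mul_le_mul_right x.length (hpos x.length)
      rw [hm]
      dsimp only
      rw [mul_add (p _)]
      omega
    obtain ⟨V, hV, hsim⟩ := exists_ev_simulate hD hb₀ hks hG (hγ (m x.length)) (h₀ (m x.length)) []
      (zeros (x.length + K)) (p x.length + p x.length) (some N.main) N.initialState none
      (N.initCfg x).stk hS
    have hjoin : (Function.update (fun _ => []) (.inl N.inp) (x.map N.inpAlphabet.symm) :
        ((memStep N.toOracleNTM).prod W).Stk) = Memory.join (N.initCfg x).stk fun _ => [] := by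
      rw [← Memory.join_nil]
      exact Memory.update_join_inl ..
    rw [N.gap_eq_gapFrom B x hle]
    have hV' := hV ((N.halts B x).mono hle).1
    apply Ev.mono
    · apply Ev.seq
      apply hclock
      rw [← congrFun hp x.length]
      apply Ev.seq
      apply Ev.copyW (by decide) (by decide) (by decide)
      simp only [wstk_P, wstk_R, wstk_C, length_zeros, reverse_zeros, List.append_nil,
        update_wstk_P, update_wstk_R, update_wstk_C]
      apply Ev.seq
      apply Ev.copyW (by decide) (by decide) (by decide)
      simp only [wstk_P, wstk_R, wstk_C, length_zeros, reverse_zeros, List.append_nil,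
        update_wstk_P, update_wstk_R, update_wstk_C, zeros_append]
      apply Ev.seq
      apply Ev.mulPU
      rw [← congrFun hm x.length]
      apply Ev.seq
      apply Ev.moveW (by decide)
      simp only [wstk_X, wstk_T, List.map_id, List.append_nil, update_wstk_T, update_wstk_X]
      apply Ev.seq
      apply Ev.moveOut
      simp only [wstk_T, update_wstk_T, List.map_reverse, List.reverse_reverse, List.append_nil]
      apply Ev.seq
      have := hsim none false false
      rw [if_neg (by simp), hV', ← hjoin] at this
      refine Ev.imp this ?_
      rintro v S w rfl
      exact Ev.load rfl
    · simp
  obtain ⟨M, hM, h⟩ := hGapP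
  refine ⟨M, hM, fun x => ?_⟩
  rw [hA]
  have h1 := h x
  have h2 : 0 < γ (m x.length) ^ (p x.length + p x.length) :=
    (Even.add_self _).pow_pos (hne _)
  have h3 : N.rej B x < N.acc B x ↔ 0 < N.gap B x := by rw [PolyNTM.gap]; omega
  have h4 : M.rej ∅ x < M.acc ∅ x ↔ 0 < M.gap ∅ x := by rw [PolyNTM.gap]; omega
  rw [h3, h4, ← h1]
  exact (mul_pos_iff_of_pos_left h2).symm

/-! ## The classes -/

theorem OracleNTM.numPaths_le (M : OracleNTM) (O : Set (List Bool)) (b : Bool) (t : ℕ)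
    (c : M.Cfg) : M.numPaths O b t c ≤ 2 ^ t := by
  induction t generalizing c with
  | zero =>
    rw [numPaths]
    split <;> simp
  | succ t ih =>
    obtain ⟨_ | l, v, S⟩ := c
    · rw [Chart.numPaths_none]
      have := Nat.one_le_two_pow (n := t + 1)
      split <;> omega
    · rw [numPaths, next, pow_succ]
      have ih' := fun c => (ih c).trans (Nat.le_mul_of_pos_right (2 ^ t) two_pos)
      cases hl : M.prog l
      · simpa [hl] using ih' _
      · simpa [hl, mul_two] using add_le_add (ih _) (ih _)
      · simpa [hl] using ih' _

theorem PolyNTM.natAbs_gap_le (N : PolyNTM) (O : Set (List Bool)) (x : List Bool) :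
    (N.gap O x).natAbs ≤ 2 ^ N.time.eval x.length := by
  have h₁ : N.acc O x ≤ _ := N.numPaths_le O true _ _
  have h₂ : N.rej O x ≤ _ := N.numPaths_le O false _ _
  rw [PolyNTM.gap]
  omega

/-- Without queries, the successors of a configuration do not depend on the oracle. -/
theorem OracleNTM.numPaths_eq_of_queryFree {M : OracleNTM} (hM : M.QueryFree)
    (O O' : Set (List Bool)) (b : Bool) (t : ℕ) (c : M.Cfg) :
    M.numPaths O b t c = M.numPaths O' b t c := by
  have hnext : ∀ c, M.next O c = M.next O' c := by
    rintro ⟨_ | l, v, S⟩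
    · rfl
    · rw [OracleNTM.next, OracleNTM.next]
      split
      · rfl
      · rfl
      · rename_i h
        exact absurd h (hM _ _ _)
  induction t generalizing c with
  | zero => rfl
  | succ t ih =>
    rw [OracleNTM.numPaths, OracleNTM.numPaths, hnext]
    congr 2
    exact List.map_congr_left fun c _ => ih c

/-- The set is the support of the gap function `acc - f`, and each nonzero value of it serves as its
own target: the value itself is encoded by the index. -/
theorem coCeqP_subset_ExpLWPP : coCeqP ⊆ ExpLWPP := by
  rintro A ⟨N, hN, f, hf, h⟩
  obtain ⟨M, hM, hg⟩ := sub_mem_GapP hN hf true id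
  -- The gap is at most `2 ^ time` in absolute value. The index, with one more digit for the sign,
  -- is at most `2 * 2 ^ time + 1 ≤ 2 ^ (time + 2)`; this is the origin of the constant `2`.
  obtain ⟨c, hc, hle⟩ := (PolyBdd.add (.eval M.time) (.const 2)).exists_le_pow_add
  have hA : ∀ x, x ∈ A ↔ M.gap ∅ x ≠ 0 := fun x => by
    rw [← hg, ← not_iff_not, ← Set.mem_compl_iff, h]
    simp [sub_eq_zero]
  refine ⟨c, hc, M.gap ∅, ⟨M, hM, fun _ => rfl⟩, _, signedBits_mem_FP,
    fun n i _ => signedBits_ne_zero _ _, fun x => ⟨fun hx => ?_, fun hx => ?_⟩⟩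
  · have hx' := (hA x).1 hx
    obtain ⟨z, hz⟩ : ∃ z, z = M.gap ∅ x := ⟨_, rfl⟩
    rw [← hz] at hx' ⊢
    refine ⟨Nat.bit (decide (z < 0)) z.natAbs, ?_, ?_, ?_⟩
    · rw [Nat.bit_val]
      omega
    · have h1 := M.natAbs_gap_le ∅ x
      rw [← hz] at h1
      have h2 := Nat.pow_le_pow_right (n := 2) (by omega) (hle x.length)
      dsimp only at h2 ⊢
      rw [pow_add] at h2
      have h3 : Nat.bit (decide (z < 0)) z.natAbs ≤ 2 * z.natAbs + 1 := by
        rw [Nat.bit_val]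
        have := Bool.toNat_le (decide (z < 0))
        omega
      omega
    · have hb : (Nat.bit (decide (z < 0)) z.natAbs).bits = decide (z < 0) :: z.natAbs.bits :=
        Nat.bits_append_bit _ _ fun h => by omega
      simp only [hb, stripFst_pair, List.head?_cons, Option.getD_some, List.tail_cons]
      exact (signedBits_bits hx').symm
  · by_contra h0
    exact hx ((hA x).2 h0)

/-- Only the nonvanishing of the targets matters: it makes the set the support of `g`. Neither the
number of targets nor their computability is needed. -/
theorem ExpLWPP_subset_coCeqP : ExpLWPP ⊆ coCeqP := by
  rintro A ⟨c, -, g, hg, f, -, hf, h⟩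
  have : A = {x | g x ≠ 0} := by
    ext x
    constructor
    · intro hx
      obtain ⟨i, hi, -, e⟩ := (h x).1 hx
      rw [Set.mem_ofPred_eq, e]
      exact hf _ _ hi
    · intro hx
      by_contra h0
      exact hx ((h x).2 h0)
  rw [this]
  exact support_mem_coCeqP hg

/-- The complement consists of the inputs without accepting paths, where `acc` equals the constant
function `0`. -/
theorem NP_subset_coCeqP : NP ⊆ coCeqP := by
  rintro A ⟨N, hN, h⟩
  refine ⟨N, hN, _, zero_mem_FP, fun x => ?_⟩
  rw [Set.mem_compl_iff, h]
  simp

/-- Sets in `LWPP` and their complements are the supports of gap functions. -/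
theorem exists_support_of_mem_LWPP {B : Set (List Bool)} (hB : B ∈ LWPP) :
    (∃ g ∈ GapP, ∀ x, g x ≠ 0 ↔ x ∈ B) ∧ ∃ g ∈ GapP, ∀ x, g x ≠ 0 ↔ x ∉ B := by
  obtain ⟨g, hg, f, hf, hne, h⟩ := hB
  have hB : ∀ x, g x ≠ 0 ↔ x ∈ B := fun x => by
    constructor
    · intro hx
      by_contra h0
      exact hx ((h x).2 h0)
    · intro hx
      rw [(h x).1 hx]
      exact hne _
  refine ⟨⟨g, hg, hB⟩, ?_⟩
  obtain ⟨N, hN, e⟩ := hg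
  -- The function `g x - f(0ⁿ)` with `n = |x|` is `0` on `B` and `-f(0ⁿ) ≠ 0` outside. Mapping all
  -- symbols of `x` to `0` produces the argument `0ⁿ`.
  refine ⟨_, sub_mem_GapP hN hf false fun _ => false, fun x => ?_⟩
  have hz : x.map (fun _ => false) = zeros x.length := by simp [zeros]
  have hgap : (N.acc ∅ x - (if false = true then 0 else 1) * N.rej ∅ x : ℤ) = g x := by
    rw [e, PolyNTM.gap]
    simp
  rw [hz, hgap]
  by_cases hx : x ∈ B
  · simp [hx, (h x).1 hx]
  · simp [hx, (h x).2 hx, hne]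

/-- A machine without queries ignores its oracle; the inclusion of NP only ensures that `C` contains
some oracle. -/
theorem PP_subset_PPRel {C : Set (Set (List Bool))} (hC : NP ⊆ C) : PP ⊆ PPRel C := by
  rintro A ⟨N, hN, h⟩
  refine Set.mem_biUnion (x := {x | 0 < N.acc ∅ x}) (hC ⟨N, hN, fun _ => Iff.rfl⟩)
    ⟨N, fun x => ?_⟩
  have key : ∀ O, N.acc O x = N.acc ∅ x ∧ N.rej O x = N.rej ∅ x := fun O =>
    ⟨OracleNTM.numPaths_eq_of_queryFree hN .., OracleNTM.numPaths_eq_of_queryFree hN ..⟩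
  rw [h, (key {x | 0 < N.acc ∅ x}).1, (key {x | 0 < N.acc ∅ x}).2]

/-- LWPP is used twice. For `B` it provides gap functions supported on `B` and on its complement;
for the set of correctly answered padded questions it turns mere supports into values that depend on
the length only. -/
theorem PPRel_eq_PP (hL : coCeqP ⊆ LWPP) {C : Set (Set (List Bool))} (hNP : NP ⊆ C)
    (hC : C ⊆ coCeqP) : PPRel C = PP := by
  refine (Set.iUnion₂_subset fun B hB => ?_).antisymm (PP_subset_PPRel hNP)
  obtain ⟨⟨g₁, hg₁, h₁⟩, g₂, hg₂, h₂⟩ := exists_support_of_mem_LWPP (hL (hC hB))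
  -- The padded pairs with the right answer form the support of a gap function, so they are in LWPP
  -- by the hypothesis. Their length is `m + 2`, whence `γ m = f (zeros (m + 2))`.
  obtain ⟨g, hg, f, -, hne, h⟩ := hL (support_mem_coCeqP (choose_mem_GapP hg₁ hg₂))
  have hmem : ∀ m b (y : List Bool), pad m b y ∈ {w | (if (unpad w).head?.getD false then
      g₁ (unpad w).tail else g₂ (unpad w).tail) ≠ 0} ↔ (y ∈ B ↔ b = true) := fun m b y => by
    rw [Set.mem_ofPred_eq, unpad_pad]
    cases b
    · simpa using h₂ y
    · simpa using h₁ y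
  refine PPOracle_subset_PP hg (γ := fun m => f (zeros (m + 2))) (fun _ => hne _)
    (fun m b y hy hb => ?_) (fun m b y hy hb => ?_)
  · rw [(h _).1 ((hmem m b y).2 hb), length_pad hy]
  · exact (h _).2 fun h' => hb ((hmem m b y).1 h')

end CountingClasses

theorem mainTheorem9 :
    CountingClasses.coCeqP ⊆ CountingClasses.ExpLWPP ∧
    CountingClasses.coCeqP = CountingClasses.ExpLWPP ∧
    CountingClasses.NP ⊆ CountingClasses.ExpLWPP ∧
    (CountingClasses.ExpLWPP = CountingClasses.LWPP →
      CountingClasses.NP ⊆ CountingClasses.LWPP ∧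
      CountingClasses.PPRel CountingClasses.NP = CountingClasses.PP ∧
      CountingClasses.coCeqP ⊆ CountingClasses.LWPP ∧
      CountingClasses.PPRel CountingClasses.coCeqP = CountingClasses.PP) := by
  have h : CountingClasses.coCeqP = CountingClasses.ExpLWPP :=
    CountingClasses.coCeqP_subset_ExpLWPP.antisymm CountingClasses.ExpLWPP_subset_coCeqP
  have hNP := CountingClasses.NP_subset_coCeqP
  refine ⟨h.subset, h, hNP.trans h.subset, fun hL => ?_⟩
  have hL' := (h.trans hL).subset
  exact ⟨hNP.trans hL', CountingClasses.PPRel_eq_PP hL' subset_rfl hNP, hL',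
    CountingClasses.PPRel_eq_PP hL' hNP subset_rfl⟩
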